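/- Write $\mathbb N=\{0,1,2,\dots\}$. For subsets $A,B,C$ of $\mathbb N^n$ write $C=A\oplus B$ if every $a+b$ ($a\in A$, $b\in B$) lies in $C$ and every $c\in C$ has a unique representation $c=a+b$ with $a\in A,\ b\in B$; if moreover $A,B\subset C$, then $(A,B)$ is called a $C$-pair. An $\mathbb N^*$-pair is an $\mathbb N^n$-pair for some $n\ge 1$. For $A\subset\mathbb N^n$ put $A(x)=\sum_{\mathbf a\in A}x^{\mathbf a}$, where $x=(x_1,\dots,x_n)$ and $x^{\mathbf a}=x_1^{a_1}\cdots x_n^{a_n}$. Throughout, the order in which the variables (coordinates) are listed is immaterial. An $\mathbb N^n$-pair $(T,S)$ is primitive if it is not a Cartesian product of two $\mathbb N^*$-pairs of lower dimensions, i.e. if there are no partition of the $n$ coordinates into two nonempty sets of sizes $p$ and $q$, no $\mathbb N^p$-pair $(I_1,J_1)$ and no $\mathbb N^q$-pair $(I_2,J_2)$ in the respective coordinates such that $T=I_1\times I_2$ and $S=J_1\times J_2$. Let $(T,S)$ be an $\mathbb N^n$-pair and let $j\in\{1,\dots,n\}$. Write $x=(\bar x,x_j,\bar{\bar x})$, where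 $\bar x=(x_1,\dots,x_{j-1})$ and $\bar{\bar x}=(x_{j+1},\dots,x_n)$. (1) A first type extension of $(T,S)$ is a pair $(T^*,S^*)$ given by $$T^*(x)=C(x_j)\,T(\bar x,x_j^N,\bar{\bar x}),\qquad S^*(x)=D(x_j)\,S(\bar x,x_j^N,\bar{\bar x}),$$ where $N\ge 2$ and $(C,D)$ is a $\{0,1,\dots,N-1\}$-pair. (2) A second type extension of $(T,S)$ is a pair $(T^*,S^*)$ of subsets of $\mathbb N^{n+m-1}$ given, after a suitable numbering of the $n+m-1$ variables $\bar x,y,\bar{\bar x}$, by $$T^*(\bar x,y,\bar{\bar x})=L_{\mathbf a}(y)^{\delta}\,T(\bar x,y^{\mathbf a},\bar{\bar x}),\qquad S^*(\bar x,y,\bar{\bar x})=L_{\mathbf a}(y)^{1-\delta}\,S(\bar x,y^{\mathbf a},\bar{\bar x}),$$ where $\delta\in\{0,1\}$, $m\ge 2$, $\mathbf a\in(\mathbb N\setminus\{0\})^m$, $y=(y_1,\dots,y_m)$ and $L_{\mathbf a}=\mathbb N^m\setminus(\mathbb N^m+\mathbf a)$. It is called illegal if $(T,S)=(\{0\},\mathbb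 N)$ and $\delta=0$, or $(T,S)=(\mathbb N,\{0\})$ and $\delta=1$. **Theorem.** An $\mathbb N^*$-pair $(T,S)$ is primitive if and only if there are an $\mathbb N$-pair $(T_0,S_0)$ and a finite (possibly empty) sequence of first and second type extensions, none of them illegal, that leads from $(T_0,S_0)$ to $(T,S)$. -/

import Mathlib

/-- `C = A ⊕ B`: every sum `a + b` lies in `C`, and every element of `C` is such a sum in exactly
one way. For subsets of `ℕⁿ` this says precisely that the generating series satisfy
`A(x) B(x) = C(x)`, where `A(x) = ∑ a ∈ A, x ^ a`. -/
def IsDirectSum {M : Type*} [AddCommMonoid M] (A B C : Set M) : Prop :=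
  Set.BijOn (fun p : M × M => p.1 + p.2) (A ×ˢ B) C

/-- `(A, B)` is a complementing pair of `C` (a `C`-pair). -/
def IsComplementingPair {M : Type*} [AddCommMonoid M] (A B C : Set M) : Prop :=
  IsDirectSum A B C ∧ A ⊆ C ∧ B ⊆ C

/-- A pair `(T, S)` of subsets of `ℕ ^ dim`. The coordinates (variables) are indexed by
`Fin dim`. -/
structure SetPair where
  dim : ℕ
  T : Set (Fin dim → ℕ)
  S : Set (Fin dim → ℕ)

/-- An `ℕ*`-pair: a complementing pair of `ℕⁿ` for some `n ≥ 1`. -/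
def SetPair.IsNStarPair (P : SetPair) : Prop :=
  1 ≤ P.dim ∧ IsComplementingPair P.T P.S Set.univ

/-- `P` is the Cartesian product of `P₁` and `P₂`. The bijection `e` tells which coordinates of `P`
belong to `P₁` and which to `P₂`; the order of the coordinates is immaterial. -/
def SetPair.IsCartesianProduct (P₁ P₂ P : SetPair) : Prop :=
  ∃ e : Fin P₁.dim ⊕ Fin P₂.dim ≃ Fin P.dim,
    P.T = {x | (fun i => x (e (Sum.inl i))) ∈ P₁.T ∧ (fun i => x (e (Sum.inr i))) ∈ P₂.T} ∧
    P.S = {x | (fun i => x (e (Sum.inl i))) ∈ P₁.S ∧ (fun i => x (e (Sum.inr i))) ∈ P₂.S}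

/-- A primitive `ℕ*`-pair: not a Cartesian product of two `ℕ*`-pairs of lower dimensions. -/
def SetPair.IsPrimitive (P : SetPair) : Prop :=
  P.IsNStarPair ∧
    ¬ ∃ P₁ P₂ : SetPair, P₁.IsNStarPair ∧ P₂.IsNStarPair ∧ P₁.dim < P.dim ∧ P₂.dim < P.dim ∧
      SetPair.IsCartesianProduct P₁ P₂ P

/-- The set whose generating series is `C(x_j)`, for `C ⊆ ℕ`. -/
def axisSet {n : ℕ} (j : Fin n) (C : Set ℕ) : Set (Fin n → ℕ) :=
  (fun c => Pi.single j c) '' C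

/-- The set whose generating series is obtained from `T(x)` by substituting `x_j ↦ x_j ^ N`. -/
def stretchSet {n : ℕ} (j : Fin n) (N : ℕ) (T : Set (Fin n → ℕ)) : Set (Fin n → ℕ) :=
  (fun u => Function.update u j (N * u j)) '' T

/-- First type extension:
`T*(x) = C(x_j) T(…, x_j ^ N, …)` and `S*(x) = D(x_j) S(…, x_j ^ N, …)`
for a `{0, …, N - 1}`-pair `(C, D)` with `N ≥ 2`. -/
inductive FirstTypeExtension : SetPair → SetPair → Prop
  | mk {n : ℕ} (T S T' S' : Set (Fin n → ℕ)) (j : Fin n) (N : ℕ) (C D : Set ℕ)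
      (hN : 2 ≤ N) (hCD : IsComplementingPair C D (Set.Iio N))
      (hT : IsDirectSum (axisSet j C) (stretchSet j N T) T')
      (hS : IsDirectSum (axisSet j D) (stretchSet j N S) S') :
      FirstTypeExtension ⟨n, T, S⟩ ⟨n, T', S'⟩

/-- `L_a = ℕᵐ \ (ℕᵐ + a)`. -/
def cornerSet {m : ℕ} (a : Fin m → ℕ) : Set (Fin m → ℕ) :=
  Set.univ \ Set.range (fun z : Fin m → ℕ => z + a)

/-- The set whose generating series is `A(x) ^ δ`, for `δ ∈ {0, 1}`. -/
def setPow {M : Type*} [Zero M] (A : Set M) (δ : Fin 2) : Set M :=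
  if δ = 0 then {0} else A

/-- The set whose generating series is `A(y)`, where `y` is the block of new variables: the
variables of the new space are the old `x_i`, `i ≠ j`, together with `y_1, …, y_m`. -/
def blockSet {n n' m : ℕ} {j : Fin n} (e : {i : Fin n // i ≠ j} ⊕ Fin m ≃ Fin n')
    (A : Set (Fin m → ℕ)) : Set (Fin n' → ℕ) :=
  (fun z k => Sum.elim (fun _ => 0) z (e.symm k)) '' A

/-- The set whose generating series is obtained from `T(x)` by substituting
`x_j ↦ y_1 ^ a_1 ⋯ y_m ^ a_m`. -/
def substSet {n n' m : ℕ} {j : Fin n} (e : {i : Fin n // i ≠ j} ⊕ Fin m ≃ Fin n')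
    (a : Fin m → ℕ) (T : Set (Fin n → ℕ)) : Set (Fin n' → ℕ) :=
  (fun u k => Sum.elim (fun i : {i : Fin n // i ≠ j} => u i) (fun r => u j * a r) (e.symm k)) '' T

/-- Second type extension with parameter `δ`:
`T* = L_a(y) ^ δ T(…, y ^ a, …)` and `S* = L_a(y) ^ (1 - δ) S(…, y ^ a, …)`,
where `a ∈ (ℕ \ {0})ᵐ` and `m ≥ 2`. The bijection `e` numbers the `n' = n + m - 1` variables of the
new pair; their order is immaterial. -/
inductive SecondTypeExtension (δ : Fin 2) : SetPair → SetPair → Prop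
  | mk {n n' m : ℕ} (T S : Set (Fin n → ℕ)) (T' S' : Set (Fin n' → ℕ)) (j : Fin n)
      (e : {i : Fin n // i ≠ j} ⊕ Fin m ≃ Fin n') (a : Fin m → ℕ)
      (hm : 2 ≤ m) (ha : ∀ r, a r ≠ 0)
      (hT : IsDirectSum (blockSet e (setPow (cornerSet a) δ)) (substSet e a T) T')
      (hS : IsDirectSum (blockSet e (setPow (cornerSet a) (1 - δ))) (substSet e a S) S') :
      SecondTypeExtension δ ⟨n, T, S⟩ ⟨n', T', S'⟩

/-- `Q` is an extension of `P`, of the first or of the second type. -/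
def IsExtension (P Q : SetPair) : Prop :=
  FirstTypeExtension P Q ∨ ∃ δ, SecondTypeExtension δ P Q

/-- An illegal extension: of the second type, from `({0}, ℕ)` with `δ = 0` or from `(ℕ, {0})` with
`δ = 1`. -/
def IsIllegalExtension (P Q : SetPair) : Prop :=
  (P = ⟨1, {0}, Set.univ⟩ ∧ SecondTypeExtension 0 P Q) ∨
    (P = ⟨1, Set.univ, {0}⟩ ∧ SecondTypeExtension 1 P Q)

/-- `Q` is obtained from `P` by a finite (possibly empty) sequence of extensions of the first and
second type, none of which is illegal. -/
def IsLegalFiniteExtension : SetPair → SetPair → Prop :=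
  Relation.ReflTransGen (fun P Q => IsExtension P Q ∧ ¬ IsIllegalExtension P Q)

/-!
For a pair `(T, S)` of `ℕⁿ`, being primitive means that `T` is unsplittable: for no proper nonempty
set `K` of coordinates is membership in `T` decided by the restrictions to `K` and to its
complement. If `T` splits along `K`, then so does the complement `S`, by induction on vectors.

Both types of extension substitute a monomial `y ^ a` for `x_j` and multiply `T` and `S` by the two
members of a pair of the corner `L_a`. Since `T` and `S` can be read off the extended pair,
unsplittability survives unless the substitution leaves no trace of how the new coordinates hang
together, which is the illegal case.

Conversely, let `v` be a nonzero vector of `S` of minimal support, and minimal among those with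
that support. Every vector of the face spanned by the support of `v` that does not dominate `v`
lies in `T`, so the corner of `v` can be split off: `(T, S)` is an extension of a primitive pair,
of the second type if `v` has at least two nonzero coordinates, and of the first type if `v` is a
multiple `N ≥ 2` of a unit vector. The same holds with `T` and `S` exchanged. If only unit vectors
`v` occur on both sides, then `T` and `S` are complementary faces, and `T` splits everywhere. The
dimension drops for the second type; for the first type, the vectors at which `T` fails to split
shrink.
-/

/-! ### Direct sums -/

section DirectSum

variable {M : Type*} [AddCommMonoid M] {A B C : Set M}

theorem isDirectSum_iff :
    IsDirectSum A B C ↔ (∀ a ∈ A, ∀ b ∈ B, a + b ∈ C) ∧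
      (∀ a ∈ A, ∀ b ∈ B, ∀ a' ∈ A, ∀ b' ∈ B, a + b = a' + b' → a = a' ∧ b = b') ∧
      ∀ c ∈ C, ∃ a ∈ A, ∃ b ∈ B, a + b = c := by
  simp only [IsDirectSum, Set.BijOn, Set.MapsTo, Set.InjOn, Set.SurjOn, Set.subset_def,
    Set.mem_image, Prod.forall, Prod.exists, Set.mem_prod, Prod.mk.injEq, and_imp, and_assoc,
    exists_and_left]
  grind

namespace IsDirectSum

theorem add_mem (h : IsDirectSum A B C) {a b : M} (ha : a ∈ A) (hb : b ∈ B) : a + b ∈ C :=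
  (isDirectSum_iff.1 h).1 a ha b hb

theorem unique (h : IsDirectSum A B C) {a b a' b' : M} (ha : a ∈ A) (hb : b ∈ B)
    (ha' : a' ∈ A) (hb' : b' ∈ B) (e : a + b = a' + b') : a = a' ∧ b = b' :=
  (isDirectSum_iff.1 h).2.1 a ha b hb a' ha' b' hb' e

theorem exists_add_eq (h : IsDirectSum A B C) {c : M} (hc : c ∈ C) :
    ∃ a ∈ A, ∃ b ∈ B, a + b = c :=
  (isDirectSum_iff.1 h).2.2 c hc

theorem symm (h : IsDirectSum A B C) : IsDirectSum B A C := by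
  refine isDirectSum_iff.2 ⟨fun a ha b hb => add_comm b a ▸ h.add_mem hb ha,
    fun a ha b hb a' ha' b' hb' e => ?_, fun c hc => ?_⟩
  · rw [add_comm a, add_comm a'] at e
    exact (h.unique hb ha hb' ha' e).symm
  · obtain ⟨a, ha, b, hb, e⟩ := h.exists_add_eq hc
    exact ⟨b, hb, a, ha, by rw [add_comm, e]⟩

theorem eq_right (h : IsDirectSum {0} A B) : A = B := by
  ext x
  refine ⟨fun hx => by simpa using h.add_mem rfl hx, fun hx => ?_⟩
  obtain ⟨_, rfl, b, hb, rfl⟩ := h.exists_add_eq hx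
  simpa using hb

theorem add_add_add_comm {A' B' C' E F G : Set M} (h : IsDirectSum A B C)
    (h' : IsDirectSum A' B' C') (hE : IsDirectSum C C' E) (hF : IsDirectSum A A' F)
    (hG : IsDirectSum B B' G) : IsDirectSum F G E := by
  refine isDirectSum_iff.2 ⟨fun f hf g hg => ?_, fun f₁ hf₁ g₁ hg₁ f₂ hf₂ g₂ hg₂ e => ?_,
    fun x hx => ?_⟩
  · obtain ⟨a, ha, a', ha', rfl⟩ := hF.exists_add_eq hf
    obtain ⟨b, hb, b', hb', rfl⟩ := hG.exists_add_eq hg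
    rw [_root_.add_add_add_comm]
    exact hE.add_mem (h.add_mem ha hb) (h'.add_mem ha' hb')
  · obtain ⟨a₁, ha₁, a₁', ha₁', rfl⟩ := hF.exists_add_eq hf₁
    obtain ⟨b₁, hb₁, b₁', hb₁', rfl⟩ := hG.exists_add_eq hg₁
    obtain ⟨a₂, ha₂, a₂', ha₂', rfl⟩ := hF.exists_add_eq hf₂
    obtain ⟨b₂, hb₂, b₂', hb₂', rfl⟩ := hG.exists_add_eq hg₂
    rw [_root_.add_add_add_comm, _root_.add_add_add_comm a₂] at e
    obtain ⟨e₁, e₂⟩ := hE.unique (h.add_mem ha₁ hb₁) (h'.add_mem ha₁' hb₁') (h.add_mem ha₂ hb₂)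
      (h'.add_mem ha₂' hb₂') e
    obtain ⟨rfl, rfl⟩ := h.unique ha₁ hb₁ ha₂ hb₂ e₁
    obtain ⟨rfl, rfl⟩ := h'.unique ha₁' hb₁' ha₂' hb₂' e₂
    exact ⟨rfl, rfl⟩
  · obtain ⟨c, hc, c', hc', rfl⟩ := hE.exists_add_eq hx
    obtain ⟨a, ha, b, hb, rfl⟩ := h.exists_add_eq hc
    obtain ⟨a', ha', b', hb', rfl⟩ := h'.exists_add_eq hc'
    exact ⟨a + a', hF.add_mem ha ha', b + b', hG.add_mem hb hb', _root_.add_add_add_comm _ _ _ _⟩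

variable {M' : Type*} [AddCommMonoid M']

theorem image (h : IsDirectSum A B C) (f : M →+ M') (hf : Function.Injective f) :
    IsDirectSum (f '' A) (f '' B) (f '' C) := by
  refine isDirectSum_iff.2 ⟨?_, ?_, ?_⟩
  · rintro _ ⟨a, ha, rfl⟩ _ ⟨b, hb, rfl⟩
    exact ⟨a + b, h.add_mem ha hb, map_add f a b⟩
  · rintro _ ⟨a, ha, rfl⟩ _ ⟨b, hb, rfl⟩ _ ⟨a', ha', rfl⟩ _ ⟨b', hb', rfl⟩ e
    rw [← map_add, ← map_add] at e
    obtain ⟨rfl, rfl⟩ := h.unique ha hb ha' hb' (hf e)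
    exact ⟨rfl, rfl⟩
  · rintro _ ⟨c, hc, rfl⟩
    obtain ⟨a, ha, b, hb, rfl⟩ := h.exists_add_eq hc
    exact ⟨_, ⟨a, ha, rfl⟩, _, ⟨b, hb, rfl⟩, (map_add f a b).symm⟩

theorem preimage (h : IsDirectSum A B C) (f : M' →+ M) (hf : Function.Injective f)
    (hr : ∀ a ∈ A, ∀ b ∈ B, a + b ∈ Set.range f → a ∈ Set.range f ∧ b ∈ Set.range f) :
    IsDirectSum (f ⁻¹' A) (f ⁻¹' B) (f ⁻¹' C) := by
  refine isDirectSum_iff.2 ⟨fun a ha b hb => ?_, fun a ha b hb a' ha' b' hb' e => ?_,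
    fun c hc => ?_⟩
  · rw [Set.mem_preimage, map_add]
    exact h.add_mem ha hb
  · obtain ⟨e₁, e₂⟩ := h.unique ha hb ha' hb' (by rw [← map_add, e, map_add])
    exact ⟨hf e₁, hf e₂⟩
  · obtain ⟨a, ha, b, hb, e⟩ := h.exists_add_eq hc
    obtain ⟨⟨a, rfl⟩, ⟨b, rfl⟩⟩ := hr a ha b hb (e ▸ Set.mem_range_self c)
    exact ⟨a, ha, b, hb, hf (by rw [map_add, e])⟩

end IsDirectSum

theorem isDirectSum_singleton_zero (A : Set M) : IsDirectSum {0} A A := by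
  refine isDirectSum_iff.2 ⟨by simp, ?_, fun c hc => ⟨0, rfl, c, hc, zero_add c⟩⟩
  rintro _ rfl b _ _ rfl b' _ e
  exact ⟨rfl, by simpa using e⟩

theorem isComplementingPair_univ_iff :
    IsComplementingPair A B Set.univ ↔ IsDirectSum A B Set.univ := by
  simp [IsComplementingPair]

namespace IsDirectSum

section ZeroMem

variable [Subsingleton (AddUnits M)]

theorem zero_mem (h : IsDirectSum A B C) (hC : 0 ∈ C) : 0 ∈ A ∧ 0 ∈ B := by
  obtain ⟨a, ha, b, hb, e⟩ := h.exists_add_eq hC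
  obtain ⟨rfl, rfl⟩ := add_eq_zero.1 e
  exact ⟨ha, hb⟩

theorem zero_mem_left (h : IsDirectSum A B Set.univ) : 0 ∈ A :=
  (h.zero_mem (Set.mem_univ _)).1

theorem zero_mem_right (h : IsDirectSum A B Set.univ) : 0 ∈ B :=
  (h.zero_mem (Set.mem_univ _)).2

theorem eq_zero_of_mem (h : IsDirectSum A B Set.univ) {x : M} (ha : x ∈ A) (hb : x ∈ B) :
    x = 0 :=
  (h.unique ha h.zero_mem_right h.zero_mem_left hb (by simp)).1

theorem right_eq_zero (h : IsDirectSum A B Set.univ) {a b : M} (ha : a ∈ A) (hb : b ∈ B)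
    (hab : a + b ∈ A) : b = 0 :=
  (h.unique ha hb hab h.zero_mem_right (by simp)).2

theorem left_eq_zero (h : IsDirectSum A B Set.univ) {a b : M} (ha : a ∈ A) (hb : b ∈ B)
    (hab : a + b ∈ B) : a = 0 :=
  (h.unique ha hb h.zero_mem_left hab (by simp)).1

end ZeroMem

end IsDirectSum

end DirectSum

/-! ### Splitting along a set of coordinates -/

section Splitting

variable {ι : Type*} {K : Set ι} {A B : Set (ι → ℕ)} {x y : ι → ℕ}

/-- Membership of `x` in `A` is decided by the restrictions of `x` to `K` and to its complement.
If this holds for all `x`, then `A` is the product of its two faces. -/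
def SplitsAt (K : Set ι) (A : Set (ι → ℕ)) (x : ι → ℕ) : Prop :=
  x ∈ A ↔ K.indicator x ∈ A ∧ Kᶜ.indicator x ∈ A

theorem splitsAt_of_indicator_eq_zero (h0 : 0 ∈ A) (hx : K.indicator x = 0) : SplitsAt K A x := by
  have hxc : Kᶜ.indicator x = x := by simpa [hx] using Set.indicator_self_add_compl K x
  simp [SplitsAt, hx, hxc, h0]

theorem apply_ne_zero_of_not_splitsAt {j : ι} (h0 : 0 ∈ A) (hx : ¬ SplitsAt {j} A x) : x j ≠ 0 :=
  fun h => hx <| splitsAt_of_indicator_eq_zero h0 <| by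
    classical simp [Set.indicator_singleton, h]

theorem splitsAt_setOf_support_subset (K J : Set ι) (x : ι → ℕ) :
    SplitsAt K {x | x.support ⊆ J} x := by
  have hx : x.support = K ∩ x.support ∪ Kᶜ ∩ x.support := by
    rw [← Set.union_inter_distrib_right, Set.union_compl_self, Set.univ_inter]
  simp only [SplitsAt, Set.mem_ofPred_eq, Set.support_indicator]
  rw [← Set.union_subset_iff, ← hx]

theorem splitsAt_add_of_le {a b : ι → ℕ} (ha : a ≤ K.indicator x) (hb : b ≤ Kᶜ.indicator x) :
    SplitsAt K A (a + b) ↔ (a + b ∈ A ↔ a ∈ A ∧ b ∈ A) := by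
  have haK : K.indicator (a + b) = a := by
    ext i; have := ha i; have := hb i; by_cases hi : i ∈ K <;> simp_all
  have hbK : Kᶜ.indicator (a + b) = b := by
    ext i; have := ha i; have := hb i; by_cases hi : i ∈ K <;> simp_all
  rw [SplitsAt, haK, hbK]

namespace IsDirectSum

theorem splitsAt_right [Finite ι] (h : IsDirectSum A B Set.univ)
    (hx : ∀ x' ≤ x, SplitsAt K A x') : SplitsAt K B x := by
  induction x using WellFoundedLT.induction with | ind x ih => ?_
  replace ih : ∀ t s : ι → ℕ, t + s = x → t ≠ 0 → SplitsAt K B s := by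
    rintro t s rfl ht
    have hlt : s < t + s := lt_add_of_pos_left s (pos_iff_ne_zero.2 ht)
    exact ih s hlt fun x' hx' => hx x' (hx'.trans hlt.le)
  obtain ⟨t₁, ht₁, s₁, hs₁, e₁⟩ := h.exists_add_eq (Set.mem_univ (K.indicator x))
  obtain ⟨t₂, ht₂, s₂, hs₂, e₂⟩ := h.exists_add_eq (Set.mem_univ (Kᶜ.indicator x))
  have hsum : (t₁ + t₂) + (s₁ + s₂) = x := by
    rw [_root_.add_add_add_comm, e₁, e₂, Set.indicator_self_add_compl]
  have ht : t₁ + t₂ ∈ A := by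
    have h₁ : t₁ ≤ K.indicator x := e₁ ▸ le_self_add
    have h₂ : t₂ ≤ Kᶜ.indicator x := e₂ ▸ le_self_add
    exact ((splitsAt_add_of_le h₁ h₂).1 (hx _ (hsum ▸ le_self_add))).2 ⟨ht₁, ht₂⟩
  by_cases ht0 : t₁ + t₂ = 0
  · obtain ⟨rfl, rfl⟩ := add_eq_zero.1 ht0
    rw [zero_add] at e₁ e₂
    suffices x ∈ B by simp [SplitsAt, this, ← e₁, ← e₂, hs₁, hs₂]
    obtain ⟨t, htA, s, hsB, e⟩ := h.exists_add_eq (Set.mem_univ x)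
    suffices ht : t = 0 by simpa [← e, ht] using hsB
    by_contra htne
    obtain ⟨htK, htK'⟩ := (hx t (e ▸ le_self_add)).1 htA
    obtain ⟨hsK, hsK'⟩ := (ih t s e htne).1 hsB
    have h₁ := h.left_eq_zero htK hsK (by rwa [← Set.indicator_add', e, ← e₁])
    have h₂ := h.left_eq_zero htK' hsK' (by rwa [← Set.indicator_add', e, ← e₂])
    exact htne (by rw [← Set.indicator_self_add_compl K t, h₁, h₂, add_zero])
  · have hs : s₁ + s₂ ∈ B := by
      have h₁ : s₁ ≤ K.indicator x := e₁ ▸ le_add_self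
      have h₂ : s₂ ≤ Kᶜ.indicator x := e₂ ▸ le_add_self
      exact ((splitsAt_add_of_le h₁ h₂).1 (ih _ _ hsum ht0)).2 ⟨hs₁, hs₂⟩
    refine iff_of_false (fun hxB => ht0 (h.left_eq_zero ht hs (hsum ▸ hxB)))
      fun ⟨h₁, h₂⟩ => ht0 ?_
    rw [h.left_eq_zero ht₁ hs₁ (e₁ ▸ h₁), h.left_eq_zero ht₂ hs₂ (e₂ ▸ h₂), add_zero]

end IsDirectSum

/-- Along every proper nonempty set of coordinates, `A` fails to split at some point. -/
def IsUnsplittable (A : Set (ι → ℕ)) : Prop :=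
  ∀ K : Set ι, K.Nonempty → K ≠ Set.univ → ∃ x, ¬ SplitsAt K A x

/-- A bounded form of `IsUnsplittable`; the bound `y` is the quantity that drops in the descent
when the dimension does not. -/
def IsUnsplittableBelow (A : Set (ι → ℕ)) (y : ι → ℕ) : Prop :=
  ∀ K : Set ι, K.Nonempty → K ≠ Set.univ → ∃ x ≤ y, ¬ SplitsAt K A x

namespace IsUnsplittableBelow

theorem apply_ne_zero [Nontrivial ι] (hA : IsUnsplittableBelow A y) (h0 : 0 ∈ A) (j : ι) :
    y j ≠ 0 := by
  obtain ⟨x, hxy, hx⟩ := hA {j} (Set.singleton_nonempty j) (Set.singleton_ne_univ j)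
  exact ((Nat.pos_of_ne_zero (apply_ne_zero_of_not_splitsAt h0 hx)).trans_le (hxy j)).ne'

theorem of_isDirectSum [Finite ι] (hA : IsUnsplittableBelow A y)
    (h : IsDirectSum A B Set.univ) : IsUnsplittableBelow B y := by
  intro K hK hK'
  by_contra! hB
  obtain ⟨x, hx, hxA⟩ := hA K hK hK'
  exact hxA (h.symm.splitsAt_right fun x' hx' => hB x' (hx'.trans hx))

end IsUnsplittableBelow

namespace IsUnsplittable

theorem exists_isUnsplittableBelow [Finite ι] (hA : IsUnsplittable A) :
    ∃ y, IsUnsplittableBelow A y := by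
  choose x hx using hA
  classical
  obtain ⟨y, hy⟩ := Finite.exists_le fun K : Set ι =>
    if h : K.Nonempty ∧ K ≠ Set.univ then x K h.1 h.2 else 0
  exact ⟨y, fun K hK hK' => ⟨x K hK hK', by simpa [hK, hK'] using hy K, hx K hK hK'⟩⟩

theorem subsingleton (hA : IsUnsplittable A) (h : ∀ K x, SplitsAt K A x) : Subsingleton ι := by
  by_contra hι
  have := not_subsingleton_iff_nontrivial.1 hι
  obtain ⟨i⟩ : Nonempty ι := inferInstance
  obtain ⟨x, hx⟩ := hA {i} (Set.singleton_nonempty i) (Set.singleton_ne_univ i)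
  exact hx (h {i} x)

theorem exists_apply_ne_zero [Nontrivial ι] (hA : IsUnsplittable A) (h0 : 0 ∈ A) (j : ι) :
    ∃ u ∈ A, u j ≠ 0 := by
  by_contra! hj
  obtain ⟨x, hx⟩ := hA {j} (Set.singleton_nonempty j) (Set.singleton_ne_univ j)
  have hxj : x j ≠ 0 := apply_ne_zero_of_not_splitsAt h0 hx
  refine hx (iff_of_false (fun hxA => hxj (hj x hxA)) fun hxA => hxj ?_)
  simpa using hj _ hxA.1

end IsUnsplittable

end Splitting

/-! ### Cartesian products -/

section CartesianProduct

theorem exists_equiv_fin_sum {n : ℕ} (K : Set (Fin n)) :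
    ∃ (p q : ℕ) (e : Fin p ⊕ Fin q ≃ Fin n),
      Set.range (e ∘ Sum.inl) = K ∧ Set.range (e ∘ Sum.inr) = Kᶜ := by
  classical
  refine ⟨_, _, (Equiv.sumCongr (Fintype.equivFin K).symm
    (Fintype.equivFin (Kᶜ : Set _)).symm).trans (Equiv.Set.sumCompl K), ?_, ?_⟩
  · have : Set.range (Subtype.val ∘ (Fintype.equivFin K).symm) = K := by
      rw [EquivLike.range_comp, Subtype.range_coe]
    convert this using 2
    ext r
    simp
  · have : Set.range (Subtype.val ∘ (Fintype.equivFin (Kᶜ : Set _)).symm) = Kᶜ := by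
      rw [EquivLike.range_comp, Subtype.range_coe]
    convert this using 2
    ext r
    simp

variable {ι κ : Type*} {g : κ → ι}

theorem extendByZero_comp (hg : Function.Injective g) (x : ι → ℕ) :
    Function.ExtendByZero.hom ℕ g (x ∘ g) = (Set.range g).indicator x := by
  ext i
  change Function.extend g (x ∘ g) 0 i = _
  by_cases hi : i ∈ Set.range g
  · obtain ⟨r, rfl⟩ := hi
    simp [hg.extend_apply]
  · rw [Function.extend_apply' _ _ _ hi, Set.indicator_of_notMem hi, Pi.zero_apply]

theorem mem_range_extendByZero_iff (hg : Function.Injective g) {x : ι → ℕ} :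
    x ∈ Set.range (Function.ExtendByZero.hom ℕ g) ↔ ∀ i ∉ Set.range g, x i = 0 := by
  constructor
  · rintro ⟨y, rfl⟩ i hi
    exact Function.extend_apply' _ _ _ hi
  · intro hx
    refine ⟨x ∘ g, (extendByZero_comp hg x).trans (Set.indicator_eq_self.2 fun i hi => ?_)⟩
    exact not_imp_comm.1 (hx i) hi

theorem IsDirectSum.face {A B : Set (ι → ℕ)} (h : IsDirectSum A B Set.univ)
    (hg : Function.Injective g) :
    IsDirectSum (Function.ExtendByZero.hom ℕ g ⁻¹' A) (Function.ExtendByZero.hom ℕ g ⁻¹' B)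
      Set.univ := by
  refine h.preimage _ (Function.extend_injective hg (0 : ι → ℕ)) fun a _ b _ hab => ?_
  simp only [mem_range_extendByZero_iff hg, Pi.add_apply, add_eq_zero] at hab ⊢
  exact ⟨fun i hi => (hab i hi).1, fun i hi => (hab i hi).2⟩

namespace SetPair

variable {P P₁ P₂ : SetPair}

theorem isNStarPair_iff :
    P.IsNStarPair ↔ 1 ≤ P.dim ∧ IsDirectSum P.T P.S Set.univ := by
  rw [IsNStarPair, isComplementingPair_univ_iff]

theorem IsNStarPair.isDirectSum (h : P.IsNStarPair) : IsDirectSum P.T P.S Set.univ :=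
  (isNStarPair_iff.1 h).2

theorem IsNStarPair.exists_isCartesianProduct (hP : P.IsNStarPair) {K : Set (Fin P.dim)}
    (hK : K.Nonempty) (hK' : K ≠ Set.univ) (hT : ∀ x, SplitsAt K P.T x) :
    ∃ P₁ P₂ : SetPair, P₁.IsNStarPair ∧ P₂.IsNStarPair ∧ P₁.dim < P.dim ∧ P₂.dim < P.dim ∧
      IsCartesianProduct P₁ P₂ P := by
  obtain ⟨p, q, e, he, he'⟩ := exists_equiv_fin_sum K
  have hp : 0 < p := Fin.pos_iff_nonempty.2 (Set.range_nonempty_iff_nonempty.1 (he ▸ hK))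
  have hq : 0 < q := Fin.pos_iff_nonempty.2
    (Set.range_nonempty_iff_nonempty.1 (he' ▸ Set.nonempty_compl.2 hK'))
  have hpq : p + q = P.dim := by simpa using Fintype.card_congr e
  have hinl := e.injective.comp Sum.inl_injective
  have hinr := e.injective.comp Sum.inr_injective
  have hface : ∀ A : Set (Fin P.dim → ℕ), (∀ x, SplitsAt K A x) →
      A = {x | x ∘ e ∘ Sum.inl ∈ Function.ExtendByZero.hom ℕ (e ∘ Sum.inl) ⁻¹' A ∧
        x ∘ e ∘ Sum.inr ∈ Function.ExtendByZero.hom ℕ (e ∘ Sum.inr) ⁻¹' A} := by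
    intro A hA
    ext x
    rw [Set.mem_ofPred_eq, Set.mem_preimage, Set.mem_preimage, extendByZero_comp hinl,
      extendByZero_comp hinr, he, he']
    exact hA x
  exact ⟨⟨p, _, _⟩, ⟨q, _, _⟩, isNStarPair_iff.2 ⟨hp, hP.isDirectSum.face hinl⟩,
    isNStarPair_iff.2 ⟨hq, hP.isDirectSum.face hinr⟩, by dsimp only; omega, by dsimp only; omega,
    e, hface _ hT, hface _ fun x => hP.isDirectSum.splitsAt_right fun x' _ => hT x'⟩

theorem IsCartesianProduct.splitsAt (h₁ : P₁.IsNStarPair) (h₂ : P₂.IsNStarPair)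
    (h : IsCartesianProduct P₁ P₂ P) :
    ∃ K : Set (Fin P.dim), K.Nonempty ∧ K ≠ Set.univ ∧ ∀ x, SplitsAt K P.T x := by
  obtain ⟨e, hT, -⟩ := h
  set K := Set.range (e ∘ Sum.inl)
  have hl : ∀ r, e (Sum.inl r) ∈ K := fun r => ⟨r, rfl⟩
  have hr : ∀ r, e (Sum.inr r) ∉ K := by
    rintro r ⟨r', hr'⟩
    exact Sum.inl_ne_inr (e.injective hr')
  refine ⟨K, ⟨_, hl ⟨0, h₁.1⟩⟩, fun hK => hr ⟨0, h₂.1⟩ (hK ▸ Set.mem_univ _), fun x => ?_⟩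
  have h0₁ : (fun _ => 0) ∈ P₁.T := h₁.isDirectSum.zero_mem_left
  have h0₂ : (fun _ => 0) ∈ P₂.T := h₂.isDirectSum.zero_mem_left
  simp only [SplitsAt, hT, Set.mem_ofPred_eq, Set.indicator_of_mem (hl _),
    Set.indicator_of_notMem (hr _), Set.indicator_of_notMem (Set.notMem_compl_iff.2 (hl _)),
    Set.indicator_of_mem (Set.mem_compl (hr _)), h0₁, h0₂, and_true, true_and]

theorem isPrimitive_iff : P.IsPrimitive ↔ P.IsNStarPair ∧ IsUnsplittable P.T := by
  refine and_congr_right fun hP => ⟨fun h K hK hK' => ?_, fun h => ?_⟩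
  · by_contra! hT
    exact h (hP.exists_isCartesianProduct hK hK' hT)
  · rintro ⟨P₁, P₂, h₁, h₂, -, -, hprod⟩
    obtain ⟨K, hK, hK', hT⟩ := hprod.splitsAt h₁ h₂
    obtain ⟨x, hx⟩ := h K hK hK'
    exact hx (hT x)

theorem IsNStarPair.isPrimitive_of_dim_eq_one (hP : P.IsNStarPair) (h1 : P.dim = 1) :
    P.IsPrimitive := by
  refine isPrimitive_iff.2 ⟨hP, fun K hK hK' => absurd ?_ hK'⟩
  have : Subsingleton (Fin P.dim) := by rw [h1]; infer_instance
  exact Subsingleton.eq_univ_of_nonempty hK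

theorem IsPrimitive.isDirectSum (hP : P.IsPrimitive) : IsDirectSum P.T P.S Set.univ :=
  hP.1.isDirectSum

/-- The pair with the roles of `T` and `S` exchanged. -/
def swap (P : SetPair) : SetPair :=
  ⟨P.dim, P.S, P.T⟩

theorem IsNStarPair.swap (hP : P.IsNStarPair) : P.swap.IsNStarPair :=
  isNStarPair_iff.2 ⟨hP.1, hP.isDirectSum.symm⟩

theorem IsCartesianProduct.swap (h : IsCartesianProduct P₁ P₂ P) :
    IsCartesianProduct P₁.swap P₂.swap P.swap :=
  let ⟨e, hT, hS⟩ := h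
  ⟨e, hS, hT⟩

theorem IsPrimitive.swap (hP : P.IsPrimitive) : P.swap.IsPrimitive := by
  refine ⟨hP.1.swap, ?_⟩
  rintro ⟨P₁, P₂, h₁, h₂, hlt₁, hlt₂, h⟩
  exact hP.2 ⟨P₁.swap, P₂.swap, h₁.swap, h₂.swap, hlt₁, hlt₂, h.swap⟩

end SetPair

end CartesianProduct

/-! ### Monomial substitutions -/

section MonomialSubst

variable {ι κ : Type*}

/-- The monomial substitution `x_c ↦ ∏_{proj i = c} y_i ^ exp i`. Both types of extension are
substitutions of this kind followed by multiplication by part of a corner. -/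
structure MonomialSubst (ι κ : Type*) where
  proj : ι → κ
  exp : ι → ℕ
  proj_surjective : Function.Surjective proj
  exp_pos : ∀ i, 0 < exp i

namespace MonomialSubst

variable (φ : MonomialSubst ι κ)

/-- The effect of a monomial substitution on exponent vectors. -/
def hom : (κ → ℕ) →+ (ι → ℕ) where
  toFun u i := φ.exp i * u (φ.proj i)
  map_zero' := by ext; simp
  map_add' u v := by ext; simp [mul_add]

/-- The exponent vectors divisible by no `∏_{proj i = c} y_i ^ exp i`; they represent each class
modulo translation by the range of `hom` exactly once. -/
def corner : Set (ι → ℕ) :=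
  {l | ∀ c, ∃ i, φ.proj i = c ∧ l i < φ.exp i}

@[simp]
theorem hom_apply (u : κ → ℕ) (i : ι) : φ.hom u i = φ.exp i * u (φ.proj i) :=
  rfl

theorem hom_injective : Function.Injective φ.hom := by
  intro u v h
  ext c
  obtain ⟨i, rfl⟩ := φ.proj_surjective c
  simpa [(φ.exp_pos i).ne'] using congrFun h i

theorem hom_indicator (K : Set κ) (u : κ → ℕ) :
    (φ.proj ⁻¹' K).indicator (φ.hom u) = φ.hom (K.indicator u) := by
  classical
  ext i
  simp [Set.indicator_apply]

theorem isLowerSet_corner : IsLowerSet φ.corner := fun _ _ hle hl c =>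
  (hl c).imp fun i hi => ⟨hi.1, (hle i).trans_lt hi.2⟩

theorem zero_mem_corner : 0 ∈ φ.corner := fun c =>
  (φ.proj_surjective c).imp fun i hi => ⟨hi, φ.exp_pos i⟩

variable {φ}

theorem le_of_hom_le_add {l : ι → ℕ} {u v : κ → ℕ} (hl : l ∈ φ.corner)
    (h : φ.hom u ≤ l + φ.hom v) : u ≤ v := by
  intro c
  obtain ⟨i, rfl, hi⟩ := hl c
  refine Nat.le_of_lt_succ (Nat.lt_of_mul_lt_mul_left (a := φ.exp i) ?_)
  calc φ.exp i * u (φ.proj i) ≤ l i + φ.exp i * v (φ.proj i) := h i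
    _ < φ.exp i + φ.exp i * v (φ.proj i) := by gcongr
    _ = φ.exp i * (v (φ.proj i) + 1) := by ring

variable (φ) in
theorem exists_corner_add_hom (x : ι → ℕ) : ∃ l ∈ φ.corner, ∃ u, l + φ.hom u = x := by
  let u : κ → ℕ := fun c => sInf ((fun i => x i / φ.exp i) '' (φ.proj ⁻¹' {c}))
  have hu : φ.hom u ≤ x := by
    intro i
    have hmin : u (φ.proj i) ≤ x i / φ.exp i := Nat.sInf_le ⟨i, rfl, rfl⟩
    exact (Nat.mul_le_mul_left _ hmin).trans (Nat.mul_div_le _ _)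
  refine ⟨x - φ.hom u, fun c => ?_, u, tsub_add_cancel_of_le hu⟩
  obtain ⟨i, hi, hmin⟩ : u c ∈ (fun i => x i / φ.exp i) '' (φ.proj ⁻¹' {c}) :=
    Nat.sInf_mem (Set.Nonempty.image _ (φ.proj_surjective c))
  obtain rfl : φ.proj i = c := hi
  refine ⟨i, rfl, ?_⟩
  rw [Pi.sub_apply, hom_apply, ← hmin, ← Nat.mod_eq_sub_mul_div]
  exact Nat.mod_lt _ (φ.exp_pos i)

theorem corner_add_hom_inj {l l' : ι → ℕ} {u v : κ → ℕ} (hl : l ∈ φ.corner)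
    (hl' : l' ∈ φ.corner) (e : l + φ.hom u = l' + φ.hom v) : l = l' ∧ u = v := by
  obtain rfl : u = v := le_antisymm (le_of_hom_le_add hl' (e ▸ le_add_self))
    (le_of_hom_le_add hl (e ▸ le_add_self))
  exact ⟨add_right_cancel e, rfl⟩

theorem corner_add_hom_eq_hom {l : ι → ℕ} {u v : κ → ℕ} (hl : l ∈ φ.corner)
    (e : l + φ.hom u = φ.hom v) : l = 0 ∧ u = v :=
  corner_add_hom_inj hl φ.zero_mem_corner (by rw [e, zero_add])

variable (φ) in
theorem isDirectSum_corner : IsDirectSum φ.corner (φ.hom '' Set.univ) Set.univ := by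
  refine isDirectSum_iff.2 ⟨by simp, ?_, fun x _ => ?_⟩
  · rintro l hl _ ⟨u, -, rfl⟩ l' hl' _ ⟨v, -, rfl⟩ e
    obtain ⟨rfl, rfl⟩ := corner_add_hom_inj hl hl' e
    exact ⟨rfl, rfl⟩
  · obtain ⟨l, hl, u, e⟩ := φ.exists_corner_add_hom x
    exact ⟨l, hl, _, ⟨u, trivial, rfl⟩, e⟩

theorem isDirectSum_image_iff {C A : Set (ι → ℕ)} {T : Set (κ → ℕ)} (hC : C ⊆ φ.corner) :
    IsDirectSum C (φ.hom '' T) A ↔ ∀ l ∈ φ.corner, ∀ u, l + φ.hom u ∈ A ↔ l ∈ C ∧ u ∈ T := by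
  constructor
  · refine fun h l hl u => ⟨fun hA => ?_, fun ⟨hlC, hu⟩ => h.add_mem hlC ⟨u, hu, rfl⟩⟩
    obtain ⟨l', hl', _, ⟨v, hv, rfl⟩, e⟩ := h.exists_add_eq hA
    obtain ⟨rfl, rfl⟩ := corner_add_hom_inj (hC hl') hl e
    exact ⟨hl', hv⟩
  · refine fun h => isDirectSum_iff.2 ⟨?_, ?_, fun x hx => ?_⟩
    · rintro l hl _ ⟨u, hu, rfl⟩
      exact (h l (hC hl) u).2 ⟨hl, hu⟩
    · rintro l hl _ ⟨u, -, rfl⟩ l' hl' _ ⟨v, -, rfl⟩ e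
      obtain ⟨rfl, rfl⟩ := corner_add_hom_inj (hC hl) (hC hl') e
      exact ⟨rfl, rfl⟩
    · obtain ⟨l, hl, u, rfl⟩ := φ.exists_corner_add_hom x
      obtain ⟨hlC, hu⟩ := (h l hl u).1 hx
      exact ⟨l, hlC, _, ⟨u, hu, rfl⟩, rfl⟩

/-- The substitution leaves all variables except `x_j` unchanged, up to renaming. -/
structure IsBlockAt (φ : MonomialSubst ι κ) (j : κ) : Prop where
  exp_eq_one : ∀ i, φ.proj i ≠ j → φ.exp i = 1
  proj_inj : ∀ i i', φ.proj i ≠ j → φ.proj i' = φ.proj i → i' = i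

variable (φ) in
/-- The exponent vector of the monomial `∏_{proj i = c} y_i ^ exp i` substituted for `x_c`. -/
noncomputable def gen (c : κ) : ι → ℕ :=
  φ.hom (({c} : Set κ).indicator 1)

theorem gen_apply_of_eq {i : ι} {c : κ} (hi : φ.proj i = c) : φ.gen c i = φ.exp i := by
  simp [gen, hi]

theorem gen_apply_of_ne {i : ι} {c : κ} (hi : φ.proj i ≠ c) : φ.gen c i = 0 := by
  simp [gen, hi]

namespace IsBlockAt

variable {j : κ} {l : ι → ℕ}

theorem apply_eq_zero (hφ : φ.IsBlockAt j) (hl : l ∈ φ.corner) {i : ι} (hi : φ.proj i ≠ j) :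
    l i = 0 := by
  obtain ⟨i', hi', hlt⟩ := hl (φ.proj i)
  obtain rfl := hφ.proj_inj i i' hi hi'
  simpa [hφ.exp_eq_one _ hi] using hlt

theorem mem_corner_iff (hφ : φ.IsBlockAt j) :
    l ∈ φ.corner ↔ (∀ i, φ.proj i ≠ j → l i = 0) ∧ ¬ φ.gen j ≤ l := by
  refine ⟨fun hl => ⟨fun i hi => hφ.apply_eq_zero hl hi, fun hle => ?_⟩, fun ⟨h0, hlt⟩ c => ?_⟩
  · obtain ⟨i, hi, hlt⟩ := hl j
    exact hlt.not_ge (gen_apply_of_eq hi ▸ hle i)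
  · obtain rfl | hc := eq_or_ne c j
    · obtain ⟨i, hi⟩ := not_forall.1 hlt
      by_cases hic : φ.proj i = c
      · exact ⟨i, hic, not_le.1 (gen_apply_of_eq hic ▸ hi)⟩
      · exact absurd (gen_apply_of_ne hic ▸ zero_le) hi
    · obtain ⟨i, rfl⟩ := φ.proj_surjective c
      exact ⟨i, rfl, by simpa [h0 i hc] using φ.exp_pos i⟩

theorem exists_apply_ne_zero (hφ : φ.IsBlockAt j) (hl : l ∈ φ.corner) (hl0 : l ≠ 0) :
    ∃ i, φ.proj i = j ∧ l i ≠ 0 := by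
  obtain ⟨i, hi⟩ := Function.ne_iff.1 hl0
  exact ⟨i, not_imp_comm.1 (hφ.apply_eq_zero hl) hi, hi⟩

theorem gen_sub_mem_corner (hφ : φ.IsBlockAt j) (hl : l ∈ φ.corner) (hl0 : l ≠ 0) :
    φ.gen j - l ∈ φ.corner := by
  obtain ⟨i, hi, hli⟩ := hφ.exists_apply_ne_zero hl hl0
  refine hφ.mem_corner_iff.2 ⟨fun i hi => by simp [gen_apply_of_ne hi], fun hle => ?_⟩
  have hle : φ.gen j i ≤ φ.gen j i - l i := hle i
  have := φ.exp_pos i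
  rw [gen_apply_of_eq hi] at hle
  omega

theorem sub_gen_lt (hφ : φ.IsBlockAt j) (hl : l ∈ φ.corner) (hl0 : l ≠ 0) :
    l - φ.gen j < l := by
  obtain ⟨i, hi, hli⟩ := hφ.exists_apply_ne_zero hl hl0
  refine Pi.lt_def.2 ⟨tsub_le_self, i, ?_⟩
  have := φ.exp_pos i
  rw [Pi.sub_apply, gen_apply_of_eq hi]
  omega

end IsBlockAt

end MonomialSubst

end MonomialSubst

section BlockExtension

variable {ι κ : Type*}

namespace MonomialSubst

/-- `A(y) = C(y) T(φ y)` and `B(y) = D(y) S(φ y)`, where `(C, D)` is a pair of the corner of `φ`.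
Both types of extension are of this form. -/
structure IsBlockExtension (φ : MonomialSubst ι κ) (C D : Set (ι → ℕ)) (T S : Set (κ → ℕ))
    (A B : Set (ι → ℕ)) : Prop where
  corner : IsDirectSum C D φ.corner
  left : IsDirectSum C (φ.hom '' T) A
  right : IsDirectSum D (φ.hom '' S) B

/-- The relation between the corner coordinate of `x` and its membership in `A` and `B` which
makes `(A, B)` a block extension with full corner in `A`. -/
def RespectsCorner (φ : MonomialSubst ι κ) (A B : Set (ι → ℕ)) (x : ι → ℕ) : Prop :=
  ∀ l ∈ φ.corner, ∀ u, l + φ.hom u = x → (x ∈ A ↔ φ.hom u ∈ A) ∧ (x ∈ B → l = 0)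

variable {φ : MonomialSubst ι κ} {j : κ} {A B : Set (ι → ℕ)} {l a b : ι → ℕ} {u : κ → ℕ}

theorem exists_corner_add_hom_of_add_eq (hr : ∀ x < l + φ.hom u, φ.RespectsCorner A B x)
    (hl : l ∈ φ.corner) (ha : a ∈ A) (hb : b ∈ B) (ha0 : a ≠ 0) (hb0 : b ≠ 0)
    (e : a + b = l + φ.hom u) :
    ∃ v w, u = v + w ∧ a = l + φ.hom v ∧ φ.hom v ∈ A ∧ b = φ.hom w := by
  have hlta : a < l + φ.hom u := e ▸ lt_add_of_pos_right a (pos_iff_ne_zero.2 hb0)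
  have hltb : b < l + φ.hom u := e ▸ lt_add_of_pos_left b (pos_iff_ne_zero.2 ha0)
  obtain ⟨l', hl', v, rfl⟩ := φ.exists_corner_add_hom a
  obtain ⟨l'', hl'', w, rfl⟩ := φ.exists_corner_add_hom b
  obtain rfl : l'' = 0 := (hr _ hltb l'' hl'' w rfl).2 hb
  rw [zero_add, add_assoc, ← map_add] at e
  obtain ⟨rfl, rfl⟩ := corner_add_hom_inj hl' hl e
  exact ⟨v, w, rfl, rfl, (hr _ hlta l' hl v rfl).1.1 ha, zero_add _⟩

variable (h : IsDirectSum A B Set.univ)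
include h

theorem add_hom_notMem_of_hom_notMem (hr : ∀ x < l + φ.hom u, φ.RespectsCorner A B x)
    (hl : l ∈ φ.corner) (hl0 : l ≠ 0) (hu : φ.hom u ∉ A) :
    l + φ.hom u ∉ A ∧ l + φ.hom u ∉ B := by
  have hlt : φ.hom u < l + φ.hom u := lt_add_of_pos_left _ (pos_iff_ne_zero.2 hl0)
  obtain ⟨v, w, rfl, hv, hw⟩ : ∃ v w, u = v + w ∧ φ.hom v ∈ A ∧ φ.hom w ∈ B := by
    obtain ⟨a, ha, b, hb, e⟩ := h.exists_add_eq (Set.mem_univ (φ.hom u))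
    have hb0 : b ≠ 0 := by
      rintro rfl
      exact hu (by rwa [← e, add_zero])
    by_cases ha0 : a = 0
    · exact ⟨0, u, (zero_add u).symm, by rwa [map_zero, ← ha0], by rwa [← e, ha0, zero_add]⟩
    · obtain ⟨v, w, rfl, -, hv, rfl⟩ := exists_corner_add_hom_of_add_eq (u := u)
        (fun x hx => hr x (hx.trans (by rwa [zero_add]))) φ.zero_mem_corner ha hb ha0 hb0
        (by rw [e, zero_add])
      exact ⟨v, w, rfl, hv, hb⟩
  have hw0 : φ.hom w ≠ 0 := fun hw0 => hu (by rwa [map_add, hw0, add_zero])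
  rw [map_add, ← add_assoc] at hr ⊢
  have hlv : l + φ.hom v ∈ A :=
    (hr _ (lt_add_of_pos_right _ (pos_iff_ne_zero.2 hw0)) l hl v rfl).1.2 hv
  refine ⟨fun hA => hw0 (h.right_eq_zero hlv hw hA), fun hB => hl0 ?_⟩
  exact (add_eq_zero.1 (h.left_eq_zero hlv hw hB)).1

variable (hcorner : φ.corner ⊆ A)
include hcorner

/-- If `l + hom u` were in `B`, then moving the overlap of `l` with the generator `g` would give
`(l - g + hom u) + g = (g - l) + (l + hom u)`, two decompositions of the same vector. -/
theorem add_hom_mem_of_hom_mem (hφ : φ.IsBlockAt j) (hg : φ.gen j ∈ B)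
    (hr : ∀ x < l + φ.hom u, φ.RespectsCorner A B x) (hl : l ∈ φ.corner) (hl0 : l ≠ 0)
    (hu : φ.hom u ∈ A) : l + φ.hom u ∈ A := by
  obtain ⟨a, ha, b, hb, e⟩ := h.exists_add_eq (Set.mem_univ (l + φ.hom u))
  suffices hb0 : b = 0 by rwa [← e, hb0, add_zero]
  by_contra hb0
  by_cases ha0 : a = 0
  · rw [ha0, zero_add] at e
    have hlow : l - φ.gen j + φ.hom u ∈ A :=
      (hr _ (add_lt_add_left (hφ.sub_gen_lt hl hl0) _) _
        (φ.isLowerSet_corner tsub_le_self hl) u rfl).1.2 hu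
    have hswap : l - φ.gen j + φ.hom u + φ.gen j = φ.gen j - l + (l + φ.hom u) := by
      ext i
      simp only [Pi.add_apply, Pi.sub_apply]
      omega
    have hgen : φ.gen j = l + φ.hom u :=
      (h.unique hlow hg (hcorner (hφ.gen_sub_mem_corner hl hl0)) (e ▸ hb) hswap).2
    exact hl0 (corner_add_hom_eq_hom hl hgen.symm).1
  · obtain ⟨v, w, rfl, -, hv, rfl⟩ := exists_corner_add_hom_of_add_eq hr hl ha hb ha0 hb0 e
    exact hb0 (h.right_eq_zero hv hb (by rwa [← map_add]))

theorem respectsCorner [Finite ι] (hφ : φ.IsBlockAt j) (hg : φ.gen j ∈ B) (x : ι → ℕ) :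
    φ.RespectsCorner A B x := by
  induction x using WellFoundedLT.induction with | ind x hr => ?_
  rintro l hl u rfl
  by_cases hl0 : l = 0
  · simp [hl0]
  by_cases hu : φ.hom u ∈ A
  · have hA := add_hom_mem_of_hom_mem h hcorner hφ hg hr hl hl0 hu
    exact ⟨iff_of_true hA hu, fun hB => (add_eq_zero.1 (h.eq_zero_of_mem hA hB)).1⟩
  · obtain ⟨hA, hB⟩ := add_hom_notMem_of_hom_notMem h hr hl hl0 hu
    exact ⟨iff_of_false hA hu, fun h => absurd h hB⟩

theorem isBlockExtension_of_corner_subset [Finite ι] (hφ : φ.IsBlockAt j) (hg : φ.gen j ∈ B) :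
    φ.IsBlockExtension φ.corner {0} (φ.hom ⁻¹' A) (φ.hom ⁻¹' B) A B := by
  have hr := respectsCorner h hcorner hφ hg
  refine ⟨(isDirectSum_singleton_zero _).symm, (isDirectSum_image_iff subset_rfl).2 ?_,
    (isDirectSum_image_iff (Set.singleton_subset_iff.2 φ.zero_mem_corner)).2 ?_⟩
  · intro l hl u
    simpa [hl] using (hr _ l hl u rfl).1
  · intro l hl u
    refine ⟨fun hB => ?_, ?_⟩
    · obtain rfl := (hr _ l hl u rfl).2 hB
      exact ⟨rfl, by simpa using hB⟩
    · rintro ⟨rfl, hu⟩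
      simpa using hu

end MonomialSubst

end BlockExtension

section BlockExtensionPrimitive

variable {ι κ : Type*}

namespace MonomialSubst

variable {φ : MonomialSubst ι κ} {j : κ} {A B C D : Set (ι → ℕ)} {T S : Set (κ → ℕ)} {K : Set ι}
  {L : Set κ} {x l : ι → ℕ} {u : κ → ℕ}

theorem preimage_proj_nonempty (hL : L.Nonempty) : (φ.proj ⁻¹' L).Nonempty :=
  hL.preimage φ.proj_surjective

theorem preimage_proj_ne_univ (hL : L ≠ Set.univ) : φ.proj ⁻¹' L ≠ Set.univ :=
  fun h => hL (φ.proj_surjective.preimage_injective (h.trans Set.preimage_univ.symm))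

namespace IsBlockExtension

theorem symm (h : φ.IsBlockExtension C D T S A B) : φ.IsBlockExtension D C S T B A :=
  ⟨h.corner.symm, h.right, h.left⟩

theorem zero_mem_left (h : φ.IsBlockExtension C D T S A B) : 0 ∈ C :=
  (h.corner.zero_mem φ.zero_mem_corner).1

theorem subset_corner (h : φ.IsBlockExtension C D T S A B) : C ⊆ φ.corner := fun l hl => by
  simpa using h.corner.add_mem hl h.symm.zero_mem_left

theorem add_hom_mem_iff (h : φ.IsBlockExtension C D T S A B) (hl : l ∈ φ.corner) :
    l + φ.hom u ∈ A ↔ l ∈ C ∧ u ∈ T :=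
  (isDirectSum_image_iff h.subset_corner).1 h.left l hl u

theorem hom_mem_iff (h : φ.IsBlockExtension C D T S A B) : φ.hom u ∈ A ↔ u ∈ T := by
  simpa [h.zero_mem_left] using h.add_hom_mem_iff (u := u) φ.zero_mem_corner

theorem isDirectSum (h : φ.IsBlockExtension C D T S A B) (hTS : IsDirectSum T S Set.univ) :
    IsDirectSum A B Set.univ :=
  h.corner.add_add_add_comm (hTS.image φ.hom φ.hom_injective) φ.isDirectSum_corner h.left h.right

theorem isDirectSum_base (h : φ.IsBlockExtension C D T S A B) (hAB : IsDirectSum A B Set.univ) :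
    IsDirectSum T S Set.univ := by
  obtain rfl : φ.hom ⁻¹' A = T := Set.ext fun _ => h.hom_mem_iff
  obtain rfl : φ.hom ⁻¹' B = S := Set.ext fun _ => h.symm.hom_mem_iff
  refine hAB.preimage φ.hom φ.hom_injective fun a ha b hb hab => ?_
  obtain ⟨c, hc, _, ⟨v, -, rfl⟩, rfl⟩ := h.left.exists_add_eq ha
  obtain ⟨d, hd, _, ⟨w, -, rfl⟩, rfl⟩ := h.right.exists_add_eq hb
  obtain ⟨u, e⟩ := hab
  rw [add_add_add_comm, ← map_add] at e
  obtain ⟨rfl, rfl⟩ := add_eq_zero.1 (corner_add_hom_eq_hom (h.corner.add_mem hc hd) e.symm).1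
  simp

theorem splitsAt_hom_iff (h : φ.IsBlockExtension C D T S A B) :
    SplitsAt (φ.proj ⁻¹' L) A (φ.hom u) ↔ SplitsAt L T u := by
  rw [SplitsAt, ← Set.preimage_compl, φ.hom_indicator, φ.hom_indicator]
  simp only [h.hom_mem_iff, SplitsAt]

theorem splitsAt_add_hom (h : φ.IsBlockExtension C D T S A B) (hφ : φ.IsBlockAt j)
    (hl : l ∈ φ.corner) (hu : SplitsAt L T u) : SplitsAt (φ.proj ⁻¹' L) A (l + φ.hom u) := by
  have hsupp : l.support ⊆ φ.proj ⁻¹' {j} := fun i hi => not_imp_comm.1 (hφ.apply_eq_zero hl) hi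
  rw [SplitsAt, ← Set.preimage_compl, Set.indicator_add', Set.indicator_add', φ.hom_indicator,
    φ.hom_indicator, h.add_hom_mem_iff hl]
  rw [SplitsAt] at hu
  by_cases hj : j ∈ L
  · have hin : (φ.proj ⁻¹' L).indicator l = l := Set.indicator_eq_self.2
      (hsupp.trans (Set.preimage_mono (by simpa using hj)))
    have hout : (φ.proj ⁻¹' Lᶜ).indicator l = 0 := Set.indicator_eq_zero'.2
      (Disjoint.mono_left hsupp (Disjoint.preimage _ (by simpa using hj)))
    simp only [hin, hout, zero_add, h.add_hom_mem_iff hl, h.hom_mem_iff, hu, and_assoc]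
  · have hin : (φ.proj ⁻¹' Lᶜ).indicator l = l := Set.indicator_eq_self.2
      (hsupp.trans (Set.preimage_mono (by simpa using hj)))
    have hout : (φ.proj ⁻¹' L).indicator l = 0 := Set.indicator_eq_zero'.2
      (Disjoint.mono_left hsupp (Disjoint.preimage _ (by simpa using hj)))
    simp only [hin, hout, zero_add, h.add_hom_mem_iff hl, h.hom_mem_iff, hu, and_left_comm]

theorem exists_not_splitsAt_base (h : φ.IsBlockExtension C D T S A B) (hφ : φ.IsBlockAt j)
    (hx : ¬ SplitsAt (φ.proj ⁻¹' L) A x) : ∃ u, φ.hom u ≤ x ∧ ¬ SplitsAt L T u := by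
  obtain ⟨l, hl, u, rfl⟩ := φ.exists_corner_add_hom x
  exact ⟨u, le_add_self, mt (h.splitsAt_add_hom hφ hl) hx⟩

theorem isUnsplittable_base (h : φ.IsBlockExtension C D T S A B) (hφ : φ.IsBlockAt j)
    (hA : IsUnsplittable A) : IsUnsplittable T := by
  intro L hL hL'
  obtain ⟨x, hx⟩ := hA _ (preimage_proj_nonempty hL) (preimage_proj_ne_univ hL')
  exact (h.exists_not_splitsAt_base hφ hx).imp fun _ hu => hu.2

theorem isUnsplittableBelow_base {y : ι → ℕ} {y' : κ → ℕ} (h : φ.IsBlockExtension C D T S A B)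
    (hφ : φ.IsBlockAt j) (hA : IsUnsplittableBelow A y) (hy : ∀ u, φ.hom u ≤ y → u ≤ y') :
    IsUnsplittableBelow T y' := by
  intro L hL hL'
  obtain ⟨x, hxy, hx⟩ := hA _ (preimage_proj_nonempty hL) (preimage_proj_ne_univ hL')
  obtain ⟨u, hux, hu⟩ := h.exists_not_splitsAt_base hφ hx
  exact ⟨u, hy u (hux.trans hxy), hu⟩

theorem exists_separated (h : φ.IsBlockExtension C D T S A B) (hφ : φ.IsBlockAt j)
    (hT : IsUnsplittable T) (hK : K.Nonempty) (hK' : K ≠ Set.univ) (hA : ∀ x, SplitsAt K A x) :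
    ∃ i ∈ K, ∃ i' ∉ K, φ.proj i = j ∧ φ.proj i' = j := by
  by_contra! hn
  have hsat : φ.proj ⁻¹' (φ.proj '' K) = K := by
    refine (Set.subset_preimage_image φ.proj K).antisymm' ?_
    rintro i' ⟨i, hi, e⟩
    by_contra hi'
    have hij : φ.proj i ≠ j := fun hij => hn i hi i' hi' hij (e ▸ hij)
    exact hi' (hφ.proj_inj i i' hij e.symm ▸ hi)
  obtain ⟨u, hu⟩ := hT (φ.proj '' K) (hK.image _) fun hu => hK' (by
    rw [← hsat, hu, Set.preimage_univ])
  exact hu (h.splitsAt_hom_iff.1 (by rw [hsat]; exact hA _))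

theorem isUnsplittable_of_injective (h : φ.IsBlockExtension C D T S A B) (hφ : φ.IsBlockAt j)
    (hinj : Function.Injective φ.proj) (hT : IsUnsplittable T) : IsUnsplittable A := by
  intro K hK hK'
  by_contra! hA
  obtain ⟨i, hi, i', hi', hij, hij'⟩ := h.exists_separated hφ hT hK hK' hA
  exact hi' (hinj (hij.trans hij'.symm) ▸ hi)

/-- When `C = {0}`, the values of an element of `A` at two coordinates over `j` vanish
simultaneously, which a splitting that separates them does not allow. -/
theorem isUnsplittable_of_singleton_zero (h : φ.IsBlockExtension {0} D T S A B)
    (hφ : φ.IsBlockAt j) (hT : IsUnsplittable T) (hu : u ∈ T) (huj : u j ≠ 0) :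
    IsUnsplittable A := by
  intro K hK hK'
  by_contra! hA
  obtain ⟨i, hi, i', hi', rfl, hij'⟩ := h.exists_separated hφ hT hK hK' hA
  obtain ⟨_, rfl, _, ⟨v, -, rfl⟩, e⟩ :=
    h.left.exists_add_eq ((hA (φ.hom u)).1 (h.hom_mem_iff.2 hu)).1
  have hvi : v (φ.proj i) = u (φ.proj i) := by simpa [hi, (φ.exp_pos i).ne'] using congrFun e i
  have hvi' : v (φ.proj i) = 0 := by simpa [hi', hij', (φ.exp_pos i').ne'] using congrFun e i'
  exact huj (hvi.symm.trans hvi')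

end IsBlockExtension

end MonomialSubst

end BlockExtensionPrimitive

/-! ### The two types of extension -/

section AxisSubst

variable {n : ℕ} {j : Fin n} {N : ℕ}

namespace MonomialSubst

/-- The substitution `x_j ↦ x_j ^ N`. -/
def axis (j : Fin n) (N : ℕ) (hN : 0 < N) : MonomialSubst (Fin n) (Fin n) where
  proj := id
  exp := Function.update 1 j N
  proj_surjective := Function.surjective_id
  exp_pos i := by
    obtain rfl | hi := eq_or_ne i j
    · simpa using hN
    · simp [hi]

theorem isBlockAt_axis (hN : 0 < N) : (axis j N hN).IsBlockAt j where
  exp_eq_one _ hi := Function.update_of_ne hi _ _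
  proj_inj _ _ _ h := h

theorem axis_hom_apply (hN : 0 < N) (u : Fin n → ℕ) :
    (axis j N hN).hom u = Function.update u j (N * u j) := by
  ext i
  obtain rfl | hi := eq_or_ne i j
  · simp [axis]
  · simp [axis, hi]

theorem axis_gen (hN : 0 < N) : (axis j N hN).gen j = Pi.single j N := by
  ext i
  obtain rfl | hi := eq_or_ne i j
  · rw [gen_apply_of_eq (by rfl), Pi.single_eq_same]
    exact Function.update_self ..
  · rw [gen_apply_of_ne (by exact hi), Pi.single_eq_of_ne hi]

end MonomialSubst

theorem stretchSet_eq_image_hom (hN : 0 < N) (T : Set (Fin n → ℕ)) :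
    stretchSet j N T = (MonomialSubst.axis j N hN).hom '' T :=
  Set.image_congr fun u _ => (MonomialSubst.axis_hom_apply hN u).symm

theorem axisSet_Iio_eq_corner (hN : 0 < N) :
    axisSet j (Set.Iio N) = (MonomialSubst.axis j N hN).corner := by
  ext l
  rw [(MonomialSubst.isBlockAt_axis hN).mem_corner_iff, MonomialSubst.axis_gen, Pi.single,
    update_le_iff]
  simp only [Pi.zero_apply, Nat.zero_le, implies_true, and_true, not_le]
  constructor
  · rintro ⟨c, hc, rfl⟩
    exact ⟨fun i (hi : i ≠ j) => Pi.single_eq_of_ne (M := fun _ => ℕ) hi c, by simpa using hc⟩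
  · rintro ⟨h0, hlt⟩
    refine ⟨l j, hlt, funext fun i => ?_⟩
    obtain rfl | hi := eq_or_ne i j
    · exact Pi.single_eq_same i _
    · exact (Pi.single_eq_of_ne hi _).trans (h0 i hi).symm

theorem IsDirectSum.axisSet {C D E : Set ℕ} (h : IsDirectSum C D E) :
    IsDirectSum (axisSet j C) (axisSet j D) (axisSet j E) :=
  h.image (AddMonoidHom.single (fun _ : Fin n => ℕ) j)
    (Pi.single_injective (M := fun _ : Fin n => ℕ) j)

theorem FirstTypeExtension.exists_isBlockExtension {P Q : SetPair} (h : FirstTypeExtension P Q) :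
    ∃ (φ : MonomialSubst (Fin Q.dim) (Fin P.dim)) (j : Fin P.dim) (C D : _),
      φ.IsBlockAt j ∧ Function.Injective φ.proj ∧ φ.IsBlockExtension C D P.T P.S Q.T Q.S := by
  obtain ⟨T, S, T', S', j, N, C, D, hN, hCD, hT, hS⟩ := h
  have hN0 : 0 < N := two_pos.trans_le hN
  rw [stretchSet_eq_image_hom hN0] at hT hS
  exact ⟨_, j, _, _, MonomialSubst.isBlockAt_axis hN0, Function.injective_id,
    axisSet_Iio_eq_corner hN0 ▸ hCD.1.axisSet, hT, hS⟩

theorem MonomialSubst.IsBlockExtension.firstTypeExtension {T S T' S' : Set (Fin n → ℕ)}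
    (hN : 2 ≤ N) (h : (axis j N (two_pos.trans_le hN)).IsBlockExtension
      (axis j N (two_pos.trans_le hN)).corner {0} T S T' S') :
    FirstTypeExtension ⟨n, T, S⟩ ⟨n, T', S'⟩ := by
  have hN0 : 0 < N := two_pos.trans_le hN
  refine .mk T S T' S' j N (Set.Iio N) {0} hN
    ⟨(isDirectSum_singleton_zero _).symm, subset_rfl, by simpa using hN0⟩ ?_ ?_
  · rw [axisSet_Iio_eq_corner hN0, stretchSet_eq_image_hom hN0]
    exact h.left
  · rw [stretchSet_eq_image_hom hN0]
    simpa [axisSet] using h.right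

theorem FirstTypeExtension.swap {P Q : SetPair} (h : FirstTypeExtension P Q) :
    FirstTypeExtension P.swap Q.swap := by
  obtain ⟨T, S, T', S', j, N, C, D, hN, ⟨hCD, hC, hD⟩, hT, hS⟩ := h
  exact .mk S T S' T' j N D C hN ⟨hCD.symm, hD, hC⟩ hS hT

end AxisSubst

section BlockSubst

variable {n n' m : ℕ} {j : Fin n} (e : {i : Fin n // i ≠ j} ⊕ Fin m ≃ Fin n') {a : Fin m → ℕ}

namespace MonomialSubst

/-- The substitution `x_j ↦ y_1 ^ a_1 ⋯ y_m ^ a_m`, with the variables numbered by `e`. -/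
def block (a : Fin m → ℕ) (hm : 0 < m) (ha : ∀ r, a r ≠ 0) :
    MonomialSubst (Fin n') (Fin n) where
  proj k := Sum.elim Subtype.val (fun _ => j) (e.symm k)
  exp k := Sum.elim (fun _ => 1) a (e.symm k)
  proj_surjective c := by
    by_cases hc : c = j
    · exact ⟨e (Sum.inr ⟨0, hm⟩), by simp [hc]⟩
    · exact ⟨e (Sum.inl ⟨c, hc⟩), by simp⟩
  exp_pos k := by
    rcases e.symm k with _ | r
    · exact one_pos
    · exact Nat.pos_of_ne_zero (ha r)

section

variable (hm : 0 < m) (ha : ∀ r, a r ≠ 0)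

@[simp]
theorem block_proj_inl (i : {i : Fin n // i ≠ j}) :
    (block e a hm ha).proj (e (Sum.inl i)) = i := by
  simp [block]

@[simp]
theorem block_proj_inr (r : Fin m) : (block e a hm ha).proj (e (Sum.inr r)) = j := by
  simp [block]

@[simp]
theorem block_exp_inl (i : {i : Fin n // i ≠ j}) :
    (block e a hm ha).exp (e (Sum.inl i)) = 1 := by
  simp [block]

@[simp]
theorem block_exp_inr (r : Fin m) : (block e a hm ha).exp (e (Sum.inr r)) = a r := by
  simp [block]

theorem isBlockAt_block : (block e a hm ha).IsBlockAt j where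
  exp_eq_one k hk := by
    obtain ⟨i | r, rfl⟩ := e.surjective k
    · simp
    · simp at hk
  proj_inj k k' hk h := by
    obtain ⟨i | r, rfl⟩ := e.surjective k
    · obtain ⟨i' | r', rfl⟩ := e.surjective k'
      · simp only [block_proj_inl] at h
        rw [Subtype.ext h]
      · simp only [block_proj_inl, block_proj_inr] at h
        exact absurd h.symm i.2
    · simp at hk

theorem block_gen_inl (i : {i : Fin n // i ≠ j}) :
    (block e a hm ha).gen j (e (Sum.inl i)) = 0 :=
  gen_apply_of_ne (by simpa using i.2)

theorem block_gen_inr (r : Fin m) : (block e a hm ha).gen j (e (Sum.inr r)) = a r := by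
  rw [gen_apply_of_eq (by simp), block_exp_inr]

end

end MonomialSubst

open MonomialSubst

theorem substSet_eq_image_hom (hm : 0 < m) (ha : ∀ r, a r ≠ 0) (T : Set (Fin n → ℕ)) :
    substSet e a T = (block e a hm ha).hom '' T := by
  refine Set.image_congr fun u _ => funext fun k => ?_
  obtain ⟨i | r, rfl⟩ := e.surjective k
  · simp
  · simp [mul_comm]

theorem blockSet_singleton_zero : blockSet e {0} = {0} := by
  rw [blockSet, Set.image_singleton]
  congr 1
  ext k
  obtain ⟨i | r, rfl⟩ := e.surjective k <;> simp

theorem mem_cornerSet_iff {l : Fin m → ℕ} : l ∈ cornerSet a ↔ ¬ a ≤ l := by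
  simp only [cornerSet, Set.mem_sdiff, Set.mem_univ, true_and, Set.mem_range, not_iff_not]
  exact ⟨fun ⟨z, hz⟩ => hz ▸ le_add_self, fun hle => ⟨l - a, tsub_add_cancel_of_le hle⟩⟩

theorem blockSet_cornerSet_eq_corner (hm : 0 < m) (ha : ∀ r, a r ≠ 0) :
    blockSet e (cornerSet a) = (block e a hm ha).corner := by
  ext l
  rw [(isBlockAt_block e hm ha).mem_corner_iff]
  have hgen : (block e a hm ha).gen j ≤ l ↔ a ≤ fun r => l (e (Sum.inr r)) := by
    rw [Pi.le_def, ← e.forall_congr_right, Sum.forall]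
    simp [block_gen_inl, block_gen_inr, Pi.le_def]
  rw [hgen, ← mem_cornerSet_iff]
  constructor
  · rintro ⟨z, hz, rfl⟩
    refine ⟨fun k hk => ?_, by simpa using hz⟩
    obtain ⟨i | r, rfl⟩ := e.surjective k
    · simp
    · simp at hk
  · rintro ⟨h0, hl⟩
    refine ⟨_, hl, funext fun k => ?_⟩
    obtain ⟨i | r, rfl⟩ := e.surjective k
    · simpa using (h0 (e (Sum.inl i)) (by simpa using i.2)).symm
    · simp

theorem SecondTypeExtension.exists_isBlockExtension {P Q : SetPair}
    (h : SecondTypeExtension 0 P Q) :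
    ∃ (φ : MonomialSubst (Fin Q.dim) (Fin P.dim)) (j : Fin P.dim),
      φ.IsBlockAt j ∧ φ.IsBlockExtension {0} φ.corner P.T P.S Q.T Q.S := by
  obtain ⟨T, S, T', S', j, e, a, hm, ha, hT, hS⟩ := h
  have hm0 : 0 < _ := two_pos.trans_le hm
  rw [substSet_eq_image_hom e hm0 ha] at hT hS
  refine ⟨block e a hm0 ha, j, isBlockAt_block e hm0 ha, isDirectSum_singleton_zero _, ?_, ?_⟩
  · simpa [setPow, blockSet_singleton_zero] using hT
  · simpa [setPow, blockSet_cornerSet_eq_corner e hm0 ha] using hS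

theorem MonomialSubst.IsBlockExtension.secondTypeExtension {T S : Set (Fin n → ℕ)}
    {T' S' : Set (Fin n' → ℕ)} (hm : 2 ≤ m) (ha : ∀ r, a r ≠ 0)
    (h : (block e a (two_pos.trans_le hm) ha).IsBlockExtension
      (block e a (two_pos.trans_le hm) ha).corner {0} T S T' S') :
    SecondTypeExtension 1 ⟨n, T, S⟩ ⟨n', T', S'⟩ := by
  refine .mk T S T' S' j e a hm ha ?_ ?_ <;> rw [substSet_eq_image_hom e (two_pos.trans_le hm) ha]
  · simpa [setPow, blockSet_cornerSet_eq_corner e (two_pos.trans_le hm) ha] using h.left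
  · simpa [setPow, blockSet_singleton_zero] using h.right

theorem SecondTypeExtension.swap {δ : Fin 2} {P Q : SetPair} (h : SecondTypeExtension δ P Q) :
    SecondTypeExtension (1 - δ) P.swap Q.swap := by
  obtain ⟨T, S, T', S', j, e, a, hm, ha, hT, hS⟩ := h
  exact .mk S T S' T' j e a hm ha hS (by rwa [sub_sub_cancel])

theorem SecondTypeExtension.dim_lt {δ : Fin 2} {P Q : SetPair} (h : SecondTypeExtension δ P Q) :
    P.dim < Q.dim := by
  obtain @⟨n, n', m, T, S, T', S', j, e, a, hm, ha, hT, hS⟩ := h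
  have hcard : n - 1 + m = n' := by simpa [Fintype.card_subtype_compl] using Fintype.card_congr e
  have := j.pos
  dsimp only
  omega

theorem IsExtension.swap {P Q : SetPair} (h : IsExtension P Q) : IsExtension P.swap Q.swap :=
  h.imp FirstTypeExtension.swap fun ⟨δ, h⟩ => ⟨1 - δ, h.swap⟩

end BlockSubst

/-! ### Legal extensions -/

section LegalExtension

variable {P Q : SetPair}

theorem MonomialSubst.IsBlockExtension.isPrimitive
    {φ : MonomialSubst (Fin Q.dim) (Fin P.dim)} {C D : Set (Fin Q.dim → ℕ)}
    (h : φ.IsBlockExtension C D P.T P.S Q.T Q.S) (hP : P.IsNStarPair) (hQ : IsUnsplittable Q.T) :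
    Q.IsPrimitive := by
  obtain ⟨i, -⟩ := φ.proj_surjective ⟨0, hP.1⟩
  exact SetPair.isPrimitive_iff.2
    ⟨SetPair.isNStarPair_iff.2 ⟨i.pos, h.isDirectSum hP.isDirectSum⟩, hQ⟩

theorem FirstTypeExtension.isPrimitive (h : FirstTypeExtension P Q) (hP : P.IsPrimitive) :
    Q.IsPrimitive := by
  obtain ⟨φ, j, C, D, hφ, hinj, hPQ⟩ := h.exists_isBlockExtension
  exact hPQ.isPrimitive hP.1
    (hPQ.isUnsplittable_of_injective hφ hinj (SetPair.isPrimitive_iff.1 hP).2)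

theorem SetPair.IsPrimitive.eq_of_forall_apply_eq_zero (hP : P.IsPrimitive) (j : Fin P.dim)
    (h0 : ∀ u ∈ P.T, u j = 0) : P = ⟨1, {0}, Set.univ⟩ := by
  obtain hsub | hnt := subsingleton_or_nontrivial (Fin P.dim)
  · have hT : P.T = {0} := Set.eq_singleton_iff_unique_mem.2 ⟨hP.isDirectSum.zero_mem_left,
      fun u hu => funext fun i => (congrArg u (Subsingleton.elim i j)).trans (h0 u hu)⟩
    have hS : P.S = Set.univ := (hT ▸ hP.isDirectSum).eq_right
    have hdim : P.dim = 1 := (Fin.subsingleton_iff_le_one.1 hsub).antisymm hP.1.1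
    obtain ⟨n, T, S⟩ := P
    obtain rfl : n = 1 := hdim
    exact congrArg₂ (SetPair.mk 1) hT hS
  · obtain ⟨u, hu, huj⟩ := (isPrimitive_iff.1 hP).2.exists_apply_ne_zero
      hP.isDirectSum.zero_mem_left j
    exact absurd (h0 u hu) huj

theorem SecondTypeExtension.isPrimitive_of_ne (h : SecondTypeExtension 0 P Q)
    (hP : P.IsPrimitive) (hne : P ≠ ⟨1, {0}, Set.univ⟩) : Q.IsPrimitive := by
  obtain ⟨φ, j, hφ, hPQ⟩ := h.exists_isBlockExtension
  obtain ⟨u, hu, huj⟩ : ∃ u ∈ P.T, u j ≠ 0 := by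
    by_contra! h0
    exact hne (hP.eq_of_forall_apply_eq_zero j h0)
  exact hPQ.isPrimitive hP.1
    (hPQ.isUnsplittable_of_singleton_zero hφ (SetPair.isPrimitive_iff.1 hP).2 hu huj)

theorem IsExtension.isPrimitive (h : IsExtension P Q) (hl : ¬ IsIllegalExtension P Q)
    (hP : P.IsPrimitive) : Q.IsPrimitive := by
  rcases h with h | ⟨δ, h⟩
  · exact h.isPrimitive hP
  obtain rfl | rfl : δ = 0 ∨ δ = 1 := by fin_cases δ <;> simp
  · exact h.isPrimitive_of_ne hP fun hP' => hl (.inl ⟨hP', h⟩)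
  · exact (h.swap.isPrimitive_of_ne hP.swap fun hP' =>
      hl (.inr ⟨congrArg SetPair.swap hP', h⟩)).swap

theorem IsLegalFiniteExtension.isPrimitive (h : IsLegalFiniteExtension P Q)
    (hP : P.IsPrimitive) : Q.IsPrimitive := by
  induction h with
  | refl => exact hP
  | tail _ h ih => exact h.1.isPrimitive h.2 ih

theorem SecondTypeExtension.not_isPrimitive
    (h : SecondTypeExtension 0 ⟨1, {0}, Set.univ⟩ Q) : ¬ Q.IsPrimitive := by
  intro hQ
  obtain ⟨φ, j, -, hPQ⟩ := h.exists_isBlockExtension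
  have hT : Q.T = {x | x.support ⊆ ∅} := by
    simpa [Set.eq_singleton_iff_unique_mem] using hPQ.left.eq_right.symm
  have hsub : Subsingleton (Fin Q.dim) := (SetPair.isPrimitive_iff.1 hQ).2.subsingleton
    fun K x => hT ▸ splitsAt_setOf_support_subset K ∅ x
  exact h.dim_lt.not_ge (Fin.subsingleton_iff_le_one.1 hsub)

theorem SetPair.IsPrimitive.not_isIllegalExtension (hQ : Q.IsPrimitive) :
    ¬ IsIllegalExtension P Q := by
  rintro (⟨rfl, h⟩ | ⟨rfl, h⟩)
  · exact h.not_isPrimitive hQ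
  · exact SecondTypeExtension.not_isPrimitive h.swap hQ.swap

end LegalExtension

/-! ### Corner generators -/

section CornerGenerator

variable {ι : Type*} {A B : Set (ι → ℕ)}

namespace IsDirectSum

theorem mem_left_of_forall_le (h : IsDirectSum A B Set.univ) {x : ι → ℕ}
    (hx : ∀ b ∈ B, b ≤ x → b = 0) : x ∈ A := by
  obtain ⟨a, ha, b, hb, rfl⟩ := h.exists_add_eq (Set.mem_univ x)
  rwa [hx b hb le_add_self, add_zero]

theorem eq_of_tsub_mem (h : IsDirectSum A B Set.univ) {b c : ι → ℕ} (hb : b ∈ B) (hc : c ∈ B)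
    (hbc : b - c ∈ A) (hcb : c - b ∈ A) : b = c := by
  have hsup : c - b + b = b - c + c := by
    ext i; simp only [Pi.add_apply, Pi.sub_apply]; omega
  exact (h.unique hcb hb hbc hc hsup).2

theorem single_one_mem_or [DecidableEq ι] (h : IsDirectSum A B Set.univ) (i : ι) :
    Pi.single i 1 ∈ A ∨ Pi.single i 1 ∈ B := by
  refine or_iff_not_imp_right.2 fun hi => h.mem_left_of_forall_le fun b hb hle => ?_
  have hatom : IsAtom (Pi.single i 1 : ι → ℕ) :=
    Pi.isAtom_single (bot_covBy_iff.1 (Nat.covBy_iff_add_one_eq.2 rfl))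
  exact (hatom.le_iff.1 hle).resolve_right fun hbi => hi (hbi ▸ hb)

theorem le_total_of_support_subset (h : IsDirectSum A B Set.univ) {Y : Set ι}
    (hY : ∀ x : ι → ℕ, x.support ⊂ Y → x ∈ A) {b c : ι → ℕ} (hb : b ∈ B) (hbY : b.support ⊆ Y)
    (hc : c ∈ B) (hcY : c.support ⊆ Y) : b ≤ c ∨ c ≤ b := by
  have tsub_mem : ∀ {b c : ι → ℕ}, b.support ⊆ Y → c.support ⊆ Y → ¬ c ≤ b → b - c ∈ A := by
    intro b c hb hc hcb
    obtain ⟨i, hi⟩ : ∃ i, b i < c i := by simpa [Pi.le_def] using hcb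
    have hsub : (b - c).support ⊆ b.support := fun k hk hk0 => hk (by simp [hk0])
    exact hY _ ((hsub.trans hb).ssubset_of_mem_notMem (hc hi.ne_bot)
      fun h => h (Nat.sub_eq_zero_of_le hi.le))
  by_contra! hbc
  exact hbc.1 (h.eq_of_tsub_mem hb hc (tsub_mem hbY hcY hbc.2) (tsub_mem hcY hbY hbc.1)).le

end IsDirectSum

/-- `v` generates `B` on its face: within the coordinates supporting `v`, all vectors not
dominating `v` lie in `A`. Hence the corner `ℕ^m \ (ℕ^m + v)` of this face can be split off `A`. -/
structure IsCornerGenerator (A B : Set (ι → ℕ)) (v : ι → ℕ) : Prop where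
  mem : v ∈ B
  ne_zero : v ≠ 0
  mem_of_not_le : ∀ l : ι → ℕ, l.support ⊆ v.support → ¬ v ≤ l → l ∈ A

namespace IsDirectSum

theorem exists_isCornerGenerator [Finite ι] (h : IsDirectSum A B Set.univ) {b : ι → ℕ}
    (hb : b ∈ B) (hb0 : b ≠ 0) :
    ∃ v, IsCornerGenerator A B v ∧ v.support ⊆ b.support := by
  obtain ⟨Y, hYb, hY⟩ := exists_minimal_le_of_wellFoundedLT
    (fun Y : Set ι => ∃ c ∈ B, c ≠ 0 ∧ c.support ⊆ Y) b.support ⟨b, hb, hb0, subset_rfl⟩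
  obtain ⟨v, ⟨hv, hv0, hvY⟩, hvmin⟩ := exists_minimal_of_wellFoundedLT _ hY.prop
  have hproper : ∀ x : ι → ℕ, x.support ⊂ Y → x ∈ A := fun x hx =>
    h.mem_left_of_forall_le fun c hc hcx => by
      by_contra hc0
      exact hY.not_prop_of_lt hx
        ⟨c, hc, hc0, fun i hi => (Nat.pos_of_ne_zero hi).trans_le (hcx i) |>.ne'⟩
  refine ⟨v, ⟨hv, hv0, fun l hl hvl => h.mem_left_of_forall_le fun c hc hcl => ?_⟩,
    hvY.trans hYb⟩
  by_contra hc0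
  have hcY : c.support ⊆ Y := fun i hi =>
    hvY (hl ((Nat.pos_of_ne_zero hi).trans_le (hcl i)).ne')
  have hvc : v ≤ c := (h.le_total_of_support_subset hproper hv hvY hc hcY).elim id
    (hvmin ⟨hc, hc0, hcY⟩)
  exact hvl (hvc.trans hcl)

variable [DecidableEq ι]

theorem setOf_support_subset_subset [Finite ι] (h : IsDirectSum A B Set.univ)
    (hB : ∀ v, IsCornerGenerator A B v → ∃ i, v = Pi.single i 1) :
    {x | x.support ⊆ {i | Pi.single i 1 ∈ A}} ⊆ A := by
  refine fun x hx => h.mem_left_of_forall_le fun b hb hbx => ?_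
  by_contra hb0
  obtain ⟨v, hv, hvb⟩ := h.exists_isCornerGenerator hb hb0
  obtain ⟨i, rfl⟩ := hB v hv
  have hbi : b i ≠ 0 := hvb (by simp)
  have hi : Pi.single i 1 ∈ A := hx ((Nat.pos_of_ne_zero hbi).trans_le (hbx i)).ne'
  exact hv.ne_zero (h.eq_zero_of_mem hi hv.mem)

theorem eq_setOf_support_subset [Finite ι] (h : IsDirectSum A B Set.univ)
    (hB : ∀ v, IsCornerGenerator A B v → ∃ i, v = Pi.single i 1)
    (hA : ∀ v, IsCornerGenerator B A v → ∃ i, v = Pi.single i 1) :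
    A = {x | x.support ⊆ {i | Pi.single i 1 ∈ A}} := by
  refine subset_antisymm (fun x hx => ?_) (h.setOf_support_subset_subset hB)
  set J : Set ι := {i | Pi.single i 1 ∈ A}
  have hxJ : J.indicator x ∈ A := h.setOf_support_subset_subset hB Set.support_indicator_subset
  have hxJc : Jᶜ.indicator x ∈ B := h.symm.setOf_support_subset_subset hA fun i hi =>
    (h.single_one_mem_or i).resolve_left (Set.mem_of_indicator_ne_zero hi)
  have h0 : Jᶜ.indicator x = 0 :=
    h.right_eq_zero hxJ hxJc (by rwa [Set.indicator_self_add_compl])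
  rwa [Set.indicator_eq_zero', disjoint_compl_right_iff] at h0

theorem exists_isCornerGenerator_or [Finite ι] (h : IsDirectSum A B Set.univ)
    (hA : ∃ K x, ¬ SplitsAt K A x) :
    (∃ v, IsCornerGenerator A B v ∧ ∀ i, v ≠ Pi.single i 1) ∨
      ∃ v, IsCornerGenerator B A v ∧ ∀ i, v ≠ Pi.single i 1 := by
  by_contra! hn
  obtain ⟨K, x, hx⟩ := hA
  rw [h.eq_setOf_support_subset hn.1 hn.2] at hx
  exact hx (splitsAt_setOf_support_subset K _ x)

end IsDirectSum

end CornerGenerator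

/-! ### Descent -/

section Complexity

namespace SetPair

variable {P Q : SetPair}

/-- The measure that drops in the descent: the dimension first, then the least coordinate sum of a
vector below which `T` fails to split along every proper nonempty set of coordinates. -/
noncomputable def complexity (P : SetPair) : ℕ ×ₗ ℕ :=
  toLex (P.dim, sInf ((fun y => ∑ i, y i) '' {y | IsUnsplittableBelow P.T y}))

theorem complexity_lt_of_dim_lt (h : P.dim < Q.dim) : P.complexity < Q.complexity :=
  Prod.Lex.toLex_lt_toLex.2 (.inl h)

theorem complexity_lt_of_isUnsplittableBelow {n : ℕ} {T S T' S' : Set (Fin n → ℕ)}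
    (hT : IsUnsplittable T)
    (h : ∀ y, IsUnsplittableBelow T y → ∃ y' < y, IsUnsplittableBelow T' y') :
    complexity ⟨n, T', S'⟩ < complexity ⟨n, T, S⟩ := by
  refine Prod.Lex.toLex_lt_toLex.2 (.inr ⟨rfl, ?_⟩)
  have hne : {y | IsUnsplittableBelow T y}.Nonempty := hT.exists_isUnsplittableBelow
  obtain ⟨y, hy, hsum⟩ := Nat.sInf_mem (hne.image fun y => ∑ i, y i)
  obtain ⟨y', hlt, hy'⟩ := h y hy
  calc sInf _ ≤ ∑ i, y' i := Nat.sInf_le (Set.mem_image_of_mem _ hy')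
    _ < ∑ i, y i := Fintype.sum_strictMono hlt
    _ = sInf _ := hsum

theorem complexity_swap (h : IsDirectSum P.T P.S Set.univ) : P.swap.complexity = P.complexity := by
  have hiff : ∀ y, IsUnsplittableBelow P.S y ↔ IsUnsplittableBelow P.T y :=
    fun y => ⟨fun hS => hS.of_isDirectSum h.symm, fun hT => hT.of_isDirectSum h⟩
  simp only [complexity, swap, hiff]
  rfl

end SetPair

end Complexity

section Reduction

open MonomialSubst

theorem IsCornerGenerator.isBlockExtension {ι κ : Type*} [Finite ι] {A B : Set (ι → ℕ)}
    {φ : MonomialSubst ι κ} {j : κ} (hφ : φ.IsBlockAt j) (h : IsDirectSum A B Set.univ)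
    (hv : IsCornerGenerator A B (φ.gen j)) :
    φ.IsBlockExtension φ.corner {0} (φ.hom ⁻¹' A) (φ.hom ⁻¹' B) A B := by
  refine isBlockExtension_of_corner_subset h (fun l hl => ?_) hφ hv.mem
  refine hv.mem_of_not_le l (fun i hi => ?_) (hφ.mem_corner_iff.1 hl).2
  have hij : φ.proj i = j := not_imp_comm.1 (hφ.apply_eq_zero hl) hi
  exact (gen_apply_of_eq hij).trans_ne (φ.exp_pos i).ne'

theorem exists_block_gen_eq {n' : ℕ} (v : Fin n' → ℕ) (hv : v.support.Nontrivial) :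
    ∃ (n m : ℕ) (j : Fin n) (e : {i : Fin n // i ≠ j} ⊕ Fin m ≃ Fin n') (a : Fin m → ℕ)
      (hm : 2 ≤ m) (ha : ∀ r, a r ≠ 0), (block e a (two_pos.trans_le hm) ha).gen j = v := by
  obtain ⟨p, m, e, hinl, hinr⟩ := exists_equiv_fin_sum v.supportᶜ
  rw [compl_compl] at hinr
  have hm : 2 ≤ m := by
    obtain ⟨i, hi, i', hi', hne⟩ := hv
    obtain ⟨r, rfl⟩ := hinr.ge hi
    obtain ⟨r', rfl⟩ := hinr.ge hi'
    exact Fin.nontrivial_iff_two_le.1 ⟨r, r', fun h => hne (congrArg _ h)⟩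
  have ha : ∀ r, v (e (Sum.inr r)) ≠ 0 := fun r => hinr.le ⟨r, rfl⟩
  refine ⟨p + 1, m, 0, (Equiv.sumCongr (finSuccAboveEquiv 0).symm (Equiv.refl _)).trans e, _, hm,
    ha, funext fun k => ?_⟩
  obtain ⟨i | r, rfl⟩ := Equiv.surjective
    ((Equiv.sumCongr (finSuccAboveEquiv 0).symm (Equiv.refl _)).trans e) k
  · rw [block_gen_inl]
    exact (not_not.1 (hinl.le ⟨_, rfl⟩)).symm
  · exact block_gen_inr ..

theorem MonomialSubst.IsBlockExtension.isPrimitive_base {P Q : SetPair}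
    {φ : MonomialSubst (Fin Q.dim) (Fin P.dim)} {j : Fin P.dim} {C D : Set (Fin Q.dim → ℕ)}
    (h : φ.IsBlockExtension C D P.T P.S Q.T Q.S) (hφ : φ.IsBlockAt j) (hQ : Q.IsPrimitive) :
    P.IsPrimitive :=
  SetPair.isPrimitive_iff.2 ⟨SetPair.isNStarPair_iff.2 ⟨j.pos, h.isDirectSum_base hQ.isDirectSum⟩,
    h.isUnsplittable_base hφ (SetPair.isPrimitive_iff.1 hQ).2⟩

namespace SetPair

variable {Q : SetPair} {v : Fin Q.dim → ℕ}

theorem IsPrimitive.exists_secondTypeExtension (hQ : Q.IsPrimitive)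
    (hv : IsCornerGenerator Q.T Q.S v) (hsupp : v.support.Nontrivial) :
    ∃ P : SetPair, P.IsPrimitive ∧ SecondTypeExtension 1 P Q := by
  obtain ⟨n, m, j, e, a, hm, ha, rfl⟩ := exists_block_gen_eq v hsupp
  have hφ := isBlockAt_block e (two_pos.trans_le hm) ha
  have hPQ := hv.isBlockExtension hφ hQ.isDirectSum
  exact ⟨⟨n, _, _⟩, hPQ.isPrimitive_base hφ hQ, hPQ.secondTypeExtension e hm ha⟩

theorem IsPrimitive.exists_firstTypeExtension (hQ : Q.IsPrimitive) (hdim : Q.dim ≠ 1)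
    {j : Fin Q.dim} {N : ℕ} (hN : 2 ≤ N) (hv : IsCornerGenerator Q.T Q.S (Pi.single j N)) :
    ∃ P : SetPair, P.IsPrimitive ∧ FirstTypeExtension P Q ∧ P.complexity < Q.complexity := by
  have hN0 : 0 < N := two_pos.trans_le hN
  have hφ := isBlockAt_axis (j := j) hN0
  rw [← axis_gen hN0] at hv
  have hPQ := hv.isBlockExtension hφ hQ.isDirectSum
  refine ⟨⟨Q.dim, (axis j N hN0).hom ⁻¹' Q.T, (axis j N hN0).hom ⁻¹' Q.S⟩,
    hPQ.isPrimitive_base hφ hQ, hPQ.firstTypeExtension hN,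
    complexity_lt_of_isUnsplittableBelow (isPrimitive_iff.1 hQ).2 fun y hy => ?_⟩
  have : Nontrivial (Fin Q.dim) := Fin.nontrivial_iff_two_le.2 (by have := hQ.1.1; omega)
  have hyj : y j ≠ 0 := hy.apply_ne_zero hQ.isDirectSum.zero_mem_left j
  refine ⟨Function.update y j (y j / N), update_lt_self_iff.2 (Nat.div_lt_self (by omega) hN),
    hPQ.isUnsplittableBelow_base hφ hy fun u hu => ?_⟩
  rw [axis_hom_apply, update_le_iff] at hu
  exact le_update_iff.2 ⟨(Nat.le_div_iff_mul_le hN0).2 ((mul_comm _ _).trans_le hu.1), hu.2⟩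

theorem IsPrimitive.exists_isExtension_of_isCornerGenerator (hQ : Q.IsPrimitive)
    (hdim : Q.dim ≠ 1) (hv : IsCornerGenerator Q.T Q.S v) (hv1 : ∀ i, v ≠ Pi.single i 1) :
    ∃ P : SetPair, P.IsPrimitive ∧ IsExtension P Q ∧ P.complexity < Q.complexity := by
  obtain hsub | hsupp := v.support.subsingleton_or_nontrivial
  · obtain ⟨j, hj⟩ := Function.ne_iff.1 hv.ne_zero
    have hvj : v = Pi.single j (v j) := Function.eq_update_iff.2
      ⟨rfl, fun i hi => by_contra fun hvi => hi (hsub hvi hj)⟩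
    have hN : 2 ≤ v j := by
      have hj1 : v j ≠ 1 := fun h => hv1 j (h ▸ hvj)
      have hj0 : v j ≠ 0 := hj
      omega
    obtain ⟨P, hP, hPQ, hlt⟩ := hQ.exists_firstTypeExtension hdim hN (hvj ▸ hv)
    exact ⟨P, hP, .inl hPQ, hlt⟩
  · obtain ⟨P, hP, hPQ⟩ := hQ.exists_secondTypeExtension hv hsupp
    exact ⟨P, hP, .inr ⟨1, hPQ⟩, complexity_lt_of_dim_lt hPQ.dim_lt⟩

theorem IsPrimitive.exists_isExtension (hQ : Q.IsPrimitive) (hdim : Q.dim ≠ 1) :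
    ∃ P : SetPair, P.IsPrimitive ∧ IsExtension P Q ∧ P.complexity < Q.complexity := by
  have hsplit : ∃ K x, ¬ SplitsAt K Q.T x := by
    by_contra! h
    have : Subsingleton (Fin Q.dim) := (isPrimitive_iff.1 hQ).2.subsingleton h
    exact hdim ((Fin.subsingleton_iff_le_one.1 this).antisymm hQ.1.1)
  obtain ⟨v, hv, hv1⟩ | ⟨v, hv, hv1⟩ := hQ.isDirectSum.exists_isCornerGenerator_or hsplit
  · exact hQ.exists_isExtension_of_isCornerGenerator hdim hv hv1
  · obtain ⟨P, hP, hPQ, hlt⟩ := hQ.swap.exists_isExtension_of_isCornerGenerator hdim hv hv1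
    refine ⟨P.swap, hP.swap, hPQ.swap, ?_⟩
    rwa [complexity_swap hP.isDirectSum, ← complexity_swap hQ.isDirectSum]

theorem IsPrimitive.exists_isLegalFiniteExtension (hQ : Q.IsPrimitive) :
    ∃ P₀ : SetPair, P₀.IsNStarPair ∧ P₀.dim = 1 ∧ IsLegalFiniteExtension P₀ Q := by
  induction h : Q.complexity using WellFoundedLT.induction generalizing Q with | ind c ih => ?_
  obtain hdim | hdim := eq_or_ne Q.dim 1
  · exact ⟨Q, hQ.1, hdim, .refl⟩
  · obtain ⟨P, hP, hPQ, hlt⟩ := hQ.exists_isExtension hdim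
    obtain ⟨P₀, h₀, h₀dim, h₀P⟩ := ih _ (h ▸ hlt) hP rfl
    exact ⟨P₀, h₀, h₀dim, h₀P.tail ⟨hPQ, hQ.not_isIllegalExtension⟩⟩

end SetPair

end Reduction

theorem mainTheorem1 (P : SetPair) (hP : P.IsNStarPair) :
    P.IsPrimitive ↔
      ∃ P₀ : SetPair, P₀.IsNStarPair ∧ P₀.dim = 1 ∧ IsLegalFiniteExtension P₀ P := by
  refine ⟨fun h => h.exists_isLegalFiniteExtension, ?_⟩
  rintro ⟨P₀, h₀, h₀dim, h₀P⟩
  exact h₀P.isPrimitive (h₀.isPrimitive_of_dim_eq_one h₀dim)
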